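/- Let $k:(0,\infty)\to[0,\infty)$ be integrable, not identically zero, and completely monotonic, i.e. $k(t)=\int_{[0,\infty)}e^{-\tau t}\,d\nu(\tau)$ for all $t>0$ with a positive Radon measure $\nu$ on $[0,\infty)$. Let $\hat k(z)=\int_0^\infty e^{-zt}k(t)\,dt$ be its Laplace transform ($\operatorname{Re} z\ge 0$). Let $\Omega=(0,1)$, let $\Gamma:H^1(\Omega)\to L^2(\partial\Omega)=\mathbb{C}^2$ be the trace (the pair of boundary values at $0$ and $1$), let $n$ be the outward normal ($n=-1$ at $0$, $n=1$ at $1$), and let $$\mathcal{H}=L^2(\Omega)\times\nabla H^1(\Omega)\times L^2_\nu\big((0,\infty);L^2(\partial\Omega)\big),$$ where $\nabla H^1(\Omega)=L^2(\Omega)$ in this one-dimensional case. The wave operator with memory boundary damping is the unbounded operator in $\mathcal{H}$ $$\mathcal{A}(p,v,\psi)=\big(v',\ p',\ -\Gamma p+\tau\psi\big),$$ whose domain consists of all $(p,v,\psi)\in\mathcal{H}$ with $p,v\in H^1(\Omega)$, $\tau\psi-\Gamma p\in L^2_\nu((0,\infty);L^2(\partial\Omega))$ and $-v\cdot n+\int_0^\infty\psi(\tau)\,d\nu(\tau)=0$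 on $\partial\Omega$ (under the preceding conditions $\psi$ is automatically $\nu$-integrable). **Proposition.** Let $H>0$. There are constants $R_0>0$ and $C$ such that for every $R\ge R_0$ there exists a natural number $n_0>0$ such that the part of the spectrum of $-\mathcal{A}$ contained in the region $$\{z\in\mathbb{C}:\ |\operatorname{Im} z|>R,\ 0<-\operatorname{Re} z<H\}$$ is given by a doubly infinite sequence $(z_n)_{n\in\mathbb{Z},\,|n|\ge n_0}$ of pairwise distinct numbers with $z_{-n}=\overline{z_n}$ for all $|n|\ge n_0$ and $$\operatorname{Im} z_n=\pi n-(2+\varepsilon_n)\operatorname{Im}\hat k(i\pi n),\qquad \operatorname{Re} z_n=-(2+\delta_n)\operatorname{Re}\hat k(i\pi n),$$ where $\varepsilon_n,\delta_n$ are real with $|\varepsilon_n|,|\delta_n|\le C\,|\hat k(i\pi n)|$ for all $|n|\ge n_0$. -/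

import Mathlib

open MeasureTheory Set
open scoped ContDiff

noncomputable section

namespace ViscoWave

/-! ### Completely monotonic kernels and the acoustic impedance -/

/-- `k` is completely monotonic on `(0, ∞)` with representing measure `ν` on `[0, ∞)`:
`k t = ∫_{[0,∞)} e^{-τ t} dν(τ)` for all `t > 0`, the integral being finite. (Finiteness forces `ν`
to be finite on bounded subsets of `[0, ∞)`, i.e. a Radon measure there. The part of `ν` on the
negative half-line never plays a role; a measure on `[0, ∞)` is extended by zero.) -/
structure IsCompletelyMonotonic (k : ℝ → ℝ) (ν : Measure ℝ) : Prop where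
  integrable : ∀ t : ℝ, 0 < t → IntegrableOn (fun τ : ℝ => Real.exp (-(τ * t))) (Ici 0) ν
  eq_integral : ∀ t : ℝ, 0 < t → k t = ∫ τ in Ici (0 : ℝ), Real.exp (-(τ * t)) ∂ν

/-- The acoustic impedance, i.e. the Laplace transform `k̂(z) = ∫₀^∞ e^{-zt} k(t) dt`. -/
def impedance (k : ℝ → ℝ) (z : ℂ) : ℂ :=
  ∫ t in Ioi (0 : ℝ), Complex.exp (-(z * (t : ℂ))) * (k t : ℂ)

/-! ### Sobolev functions on the unit interval and their boundary values -/

/-- The space `L²(0,1)` of complex-valued functions. -/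
abbrev L2Interval : Type := Lp ℂ 2 (volume.restrict (Ioo (0 : ℝ) 1))

/-- `g` is the weak (distributional) derivative of `u` on `(0,1)`. -/
def HasWeakDeriv (u g : L2Interval) : Prop :=
  ∀ φ : ℝ → ℝ, ContDiff ℝ ∞ φ → HasCompactSupport φ → tsupport φ ⊆ Ioo 0 1 →
    ∫ x in Ioo (0 : ℝ) 1, deriv φ x • u x = - ∫ x in Ioo (0 : ℝ) 1, φ x • g x

/-- The space `L²(∂Ω)` for `Ω = (0,1)`: the boundary consists of the two points `0` (index `0`)
and `1` (index `1`), and the surface measure is the counting measure. -/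
abbrev BdrySpace : Type := EuclideanSpace ℂ (Fin 2)

/-- `a` is the trace of `u`, i.e. the pair of the boundary values of the representative of `u` which
is continuous up to the boundary. Every `u` with a weak derivative in `L²(0,1)` has such a
representative. -/
def HasTrace (u : L2Interval) (a : BdrySpace) : Prop :=
  ∃ U : ℝ → ℂ, ContinuousOn U (Icc 0 1) ∧ (u =ᵐ[volume.restrict (Ioo (0 : ℝ) 1)] U) ∧
    a 0 = U 0 ∧ a 1 = U 1

/-- The outward unit normal of `(0,1)` at the boundary points `0` and `1`. -/
def outwardNormal : Fin 2 → ℂ := ![-1, 1]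

/-! ### The energy space and the wave operator -/

/-- The space `L²_ν((0,∞); L²(∂Ω))`. -/
abbrev L2Bdry (ν : Measure ℝ) : Type := Lp BdrySpace 2 (ν.restrict (Ioi (0 : ℝ)))

/-- The energy space `ℋ = L²(Ω) × ∇H¹(Ω) × L²_ν((0,∞); L²(∂Ω))` for `Ω = (0,1)` with the Hilbert
norm given by the square root of the energy. On the interval every function in `L²` is the weak
derivative of some `U` in `H¹` (see `exists_hasWeakDeriv`), so that `∇H¹(0,1) = L²(0,1)`. -/
abbrev EnergySpace (ν : Measure ℝ) : Type :=
  WithLp 2 (L2Interval × WithLp 2 (L2Interval × L2Bdry ν))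

variable {ν : Measure ℝ}

/-- The pressure component `p` of a state `(p, v, ψ)`. -/
def pComp (x : EnergySpace ν) : L2Interval := x.fst

/-- The velocity component `v` of a state `(p, v, ψ)`. -/
def vComp (x : EnergySpace ν) : L2Interval := x.snd.fst

/-- The boundary memory component `ψ` of a state `(p, v, ψ)`. -/
def psiComp (x : EnergySpace ν) : L2Bdry ν := x.snd.snd

/-- `x = (p, v, ψ)` lies in the domain of the wave operator `𝒜`, and `𝒜 x = y`:
`y = (div v, ∇p, -Γp + τψ)` belongs to the energy space, and the boundary condition
`-v·n + ∫₀^∞ ψ(τ) dν(τ) = 0` holds on `∂Ω`. -/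
def IsWaveImage (x y : EnergySpace ν) : Prop :=
  HasWeakDeriv (vComp x) (pComp y) ∧
  HasWeakDeriv (pComp x) (vComp y) ∧
  ∃ a b : BdrySpace, HasTrace (pComp x) a ∧ HasTrace (vComp x) b ∧
    (psiComp y =ᵐ[ν.restrict (Ioi (0 : ℝ))] fun τ => -a + (τ : ℂ) • psiComp x τ) ∧
    Integrable (psiComp x) (ν.restrict (Ioi (0 : ℝ))) ∧
    ∀ i : Fin 2, -(b i * outwardNormal i) + (∫ τ in Ioi (0 : ℝ), psiComp x τ ∂ν) i = 0

/-! ### The wave operator is well defined -/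

theorem L2Interval.integrable (u : L2Interval) :
    Integrable u (volume.restrict (Ioo (0 : ℝ) 1)) :=
  (Lp.memLp u).integrable one_le_two

theorem integrable_smul_of_hasCompactSupport {φ : ℝ → ℝ} (hφ : Continuous φ)
    (hc : HasCompactSupport φ) (u : L2Interval) :
    Integrable (fun x => φ x • u x) (volume.restrict (Ioo (0 : ℝ) 1)) := by
  obtain ⟨C, hC⟩ := hc.exists_bound_of_continuous hφ
  exact (L2Interval.integrable u).bdd_smul C hφ.aestronglyMeasurable
    (Filter.Eventually.of_forall hC)

theorem HasWeakDeriv.zero : HasWeakDeriv 0 0 := by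
  intro φ _ _ _
  have h0 := Lp.coeFn_zero ℂ 2 (volume.restrict (Ioo (0 : ℝ) 1))
  have e : ∀ χ : ℝ → ℝ, ∫ x in Ioo (0 : ℝ) 1, χ x • (0 : L2Interval) x = 0 := fun χ =>
    integral_eq_zero_of_ae (by filter_upwards [h0] with x hx; rw [hx]; simp)
  rw [e, e, neg_zero]

theorem HasWeakDeriv.add {u g u' g' : L2Interval} (h : HasWeakDeriv u g)
    (h' : HasWeakDeriv u' g') : HasWeakDeriv (u + u') (g + g') := by
  intro φ h1 h2 h3
  have hd : Continuous (deriv φ) := h1.continuous_deriv (by simp)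
  have i1 := integrable_smul_of_hasCompactSupport hd h2.deriv u
  have i2 := integrable_smul_of_hasCompactSupport hd h2.deriv u'
  have i3 := integrable_smul_of_hasCompactSupport h1.continuous h2 g
  have i4 := integrable_smul_of_hasCompactSupport h1.continuous h2 g'
  have e : ∀ (χ : ℝ → ℝ) (w w' : L2Interval), ∫ x in Ioo (0 : ℝ) 1, χ x • (w + w') x
      = ∫ x in Ioo (0 : ℝ) 1, (χ x • w x + χ x • w' x) := fun χ w w' =>
    integral_congr_ae (by
      filter_upwards [Lp.coeFn_add w w'] with x hx; rw [hx, Pi.add_apply, smul_add])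
  rw [e, e, integral_add i1 i2, integral_add i3 i4, h φ h1 h2 h3, h' φ h1 h2 h3, neg_add]

theorem HasWeakDeriv.smul {u g : L2Interval} (c : ℂ) (h : HasWeakDeriv u g) :
    HasWeakDeriv (c • u) (c • g) := by
  intro φ h1 h2 h3
  have e : ∀ (χ : ℝ → ℝ) (w : L2Interval), ∫ x in Ioo (0 : ℝ) 1, χ x • (c • w) x
      = ∫ x in Ioo (0 : ℝ) 1, c • (χ x • w x) := fun χ w =>
    integral_congr_ae (by
      filter_upwards [Lp.coeFn_smul c w] with x hx; rw [hx, Pi.smul_apply, smul_comm])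
  rw [e, e, integral_smul, integral_smul, h φ h1 h2 h3, smul_neg]

theorem HasWeakDeriv.eq_zero {g : L2Interval} (h : HasWeakDeriv 0 g) : g = 0 := by
  have key : ∀ᵐ x ∂(volume : Measure ℝ), x ∈ Ioo (0 : ℝ) 1 → g x = 0 := by
    refine isOpen_Ioo.ae_eq_zero_of_integral_contDiff_smul_eq_zero
      (IntegrableOn.locallyIntegrableOn (L2Interval.integrable g)) fun φ h1 h2 h3 => ?_
    have h4 := h φ h1 h2 h3
    have h0 := Lp.coeFn_zero ℂ 2 (volume.restrict (Ioo (0 : ℝ) 1))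
    rw [integral_congr_ae (g := fun _ => (0 : ℂ)) (by filter_upwards [h0] with x hx; rw [hx]; simp),
      integral_zero, zero_eq_neg] at h4
    rw [← h4, setIntegral_eq_integral_of_forall_compl_eq_zero]
    intro x hx
    rw [image_eq_zero_of_notMem_tsupport (fun hx' => hx (h3 hx')), zero_smul]
  rw [Lp.eq_zero_iff_ae_eq_zero]
  exact (ae_restrict_iff' measurableSet_Ioo).2 key

theorem HasTrace.zero : HasTrace 0 0 :=
  ⟨0, continuousOn_const, Lp.coeFn_zero _ _ _, rfl, rfl⟩

theorem HasTrace.add {u u' : L2Interval} {a a' : BdrySpace} (h : HasTrace u a)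
    (h' : HasTrace u' a') : HasTrace (u + u') (a + a') := by
  obtain ⟨U, h1, h2, h3, h4⟩ := h
  obtain ⟨U', h1', h2', h3', h4'⟩ := h'
  exact ⟨U + U', h1.add h1', (Lp.coeFn_add u u').trans (h2.add h2'), by simp [h3, h3'],
    by simp [h4, h4']⟩

theorem HasTrace.smul {u : L2Interval} {a : BdrySpace} (c : ℂ) (h : HasTrace u a) :
    HasTrace (c • u) (c • a) := by
  obtain ⟨U, h1, h2, h3, h4⟩ := h
  exact ⟨c • U, h1.const_smul c, (Lp.coeFn_smul c u).trans (h2.const_smul c), by simp [h3],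
    by simp [h4]⟩

theorem HasTrace.eq_zero {a : BdrySpace} (h : HasTrace 0 a) : a = 0 := by
  obtain ⟨U, h1, h2, h3, h4⟩ := h
  have h5 : U =ᵐ[volume.restrict (Icc (0 : ℝ) 1)] 0 := by
    rw [← restrict_Ioo_eq_restrict_Icc]
    exact h2.symm.trans (Lp.coeFn_zero _ _ _)
  have h6 : EqOn U 0 (Icc 0 1) :=
    Measure.eqOn_Icc_of_ae_eq volume zero_ne_one h5 h1 continuousOn_const
  ext i
  fin_cases i
  · simpa [h3] using h6 (by simp)
  · simpa [h4] using h6 (by simp)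

theorem IsWaveImage.zero : IsWaveImage (0 : EnergySpace ν) 0 := by
  have h0 := Lp.coeFn_zero BdrySpace 2 (ν.restrict (Ioi (0 : ℝ)))
  refine ⟨HasWeakDeriv.zero, HasWeakDeriv.zero, 0, 0, HasTrace.zero, HasTrace.zero, ?_, ?_, ?_⟩
  · change (0 : L2Bdry ν) =ᵐ[_] fun τ => -0 + (τ : ℂ) • (0 : L2Bdry ν) τ
    filter_upwards [h0] with τ hτ
    rw [hτ]
    simp
  · exact (integrable_zero _ _ _).congr h0.symm
  · intro i
    change -(0 * outwardNormal i) + (∫ τ in Ioi (0 : ℝ), (0 : L2Bdry ν) τ ∂ν) i = 0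
    rw [integral_congr_ae h0]
    simp

theorem IsWaveImage.add {x y x' y' : EnergySpace ν} (h : IsWaveImage x y)
    (h' : IsWaveImage x' y') : IsWaveImage (x + x') (y + y') := by
  obtain ⟨h1, h2, a, b, h3, h4, h5, h6, h7⟩ := h
  obtain ⟨h1', h2', a', b', h3', h4', h5', h6', h7'⟩ := h'
  have hs := Lp.coeFn_add (psiComp x) (psiComp x')
  refine ⟨h1.add h1', h2.add h2', a + a', b + b', h3.add h3', h4.add h4', ?_, ?_, ?_⟩
  · change (psiComp y + psiComp y' : L2Bdry ν) =ᵐ[_]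
      fun τ => -(a + a') + (τ : ℂ) • (psiComp x + psiComp x' : L2Bdry ν) τ
    filter_upwards [Lp.coeFn_add (psiComp y) (psiComp y'), hs, h5, h5'] with τ e1 e2 e3 e4
    rw [e1, e2, Pi.add_apply, Pi.add_apply, e3, e4, smul_add]
    abel
  · exact (h6.add h6').congr hs.symm
  · intro i
    change -((b i + b' i) * outwardNormal i) +
      (∫ τ in Ioi (0 : ℝ), (psiComp x + psiComp x' : L2Bdry ν) τ ∂ν) i = 0
    rw [integral_congr_ae hs, integral_add' h6 h6', PiLp.add_apply]
    linear_combination h7 i + h7' i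

theorem IsWaveImage.smul {x y : EnergySpace ν} (c : ℂ) (h : IsWaveImage x y) :
    IsWaveImage (c • x) (c • y) := by
  obtain ⟨h1, h2, a, b, h3, h4, h5, h6, h7⟩ := h
  have hs := Lp.coeFn_smul c (psiComp x)
  refine ⟨h1.smul c, h2.smul c, c • a, c • b, h3.smul c, h4.smul c, ?_, ?_, ?_⟩
  · change (c • psiComp y : L2Bdry ν) =ᵐ[_]
      fun τ => -(c • a) + (τ : ℂ) • (c • psiComp x : L2Bdry ν) τ
    filter_upwards [Lp.coeFn_smul c (psiComp y), hs, h5] with τ e1 e2 e3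
    rw [e1, e2, Pi.smul_apply, Pi.smul_apply, e3, smul_add, smul_neg, smul_comm]
  · exact (h6.smul c).congr hs.symm
  · intro i
    change -((c * b i) * outwardNormal i) +
      (∫ τ in Ioi (0 : ℝ), (c • psiComp x : L2Bdry ν) τ ∂ν) i = 0
    have e : ∫ τ in Ioi (0 : ℝ), (c • psiComp x : L2Bdry ν) τ ∂ν
        = c • ∫ τ in Ioi (0 : ℝ), psiComp x τ ∂ν := by
      rw [integral_congr_ae hs, ← integral_smul]
      rfl
    rw [e, PiLp.smul_apply, smul_eq_mul]
    linear_combination c * h7 i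

theorem IsWaveImage.eq_zero {y : EnergySpace ν} (h : IsWaveImage 0 y) : y = 0 := by
  obtain ⟨h1, h2, a, b, h3, -, h5, -, -⟩ := h
  have e1 : pComp y = 0 := HasWeakDeriv.eq_zero h1
  have e2 : vComp y = 0 := HasWeakDeriv.eq_zero h2
  have ha : a = 0 := HasTrace.eq_zero h3
  have e3 : psiComp y = 0 := by
    rw [Lp.eq_zero_iff_ae_eq_zero]
    refine h5.trans ?_
    change (fun τ : ℝ => -a + (τ : ℂ) • (0 : L2Bdry ν) τ) =ᵐ[_] 0
    filter_upwards [Lp.coeFn_zero BdrySpace 2 (ν.restrict (Ioi (0 : ℝ)))] with τ hτ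
    rw [hτ]
    simp [ha]
  refine WithLp.ofLp_injective 2 (Prod.ext e1 (WithLp.ofLp_injective 2 (Prod.ext e2 e3)))

variable (ν) in
/-- The graph of the wave operator, as a subspace of `ℋ × ℋ`. -/
def waveGraph : Submodule ℂ (EnergySpace ν × EnergySpace ν) where
  carrier := {q | IsWaveImage q.1 q.2}
  add_mem' := fun h h' => h.add h'
  zero_mem' := IsWaveImage.zero
  smul_mem' := fun c _ h => h.smul c

variable (ν) in
/-- The wave operator `𝒜` on the energy space, the unbounded linear operator with graph
`waveGraph ν`. -/
def waveOperator : EnergySpace ν →ₗ.[ℂ] EnergySpace ν :=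
  (waveGraph ν).toLinearPMap

/-- The graph of the wave operator is given by `IsWaveImage`. -/
theorem mem_graph_waveOperator (x y : EnergySpace ν) :
    (x, y) ∈ (waveOperator ν).graph ↔ IsWaveImage x y := by
  rw [waveOperator, Submodule.toLinearPMap_graph_eq]
  · rfl
  · rintro ⟨x, y⟩ h rfl
    exact IsWaveImage.eq_zero h

/-- Every function in `L²(0,1)` is the weak derivative of a function in `L²(0,1)`, that is
`∇H¹(0,1) = L²(0,1)`. -/
theorem exists_hasWeakDeriv (v : L2Interval) : ∃ U : L2Interval, HasWeakDeriv U v := by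
  set μ : Measure ℝ := volume.restrict (Ioo (0 : ℝ) 1) with hμ
  have hv : Integrable v μ := L2Interval.integrable v
  have hV : Continuous fun x => ∫ y in (0 : ℝ)..x, (Ioo (0 : ℝ) 1).indicator v y :=
    intervalIntegral.continuous_primitive
      (fun _ _ => ((integrable_indicator_iff measurableSet_Ioo).2 hv).intervalIntegrable) 0
  set V : ℝ → ℂ := fun x => ∫ y in (0 : ℝ)..x, (Ioo (0 : ℝ) 1).indicator v y with hVdef
  have hmem : MemLp V 2 μ := by
    obtain ⟨C, hC⟩ := isCompact_Icc.exists_bound_of_continuousOn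
      (hV.continuousOn (s := Icc (0 : ℝ) 1))
    refine MemLp.of_bound hV.aestronglyMeasurable C ?_
    exact (ae_restrict_iff' measurableSet_Ioo).2
      (Filter.Eventually.of_forall fun x hx => hC x (Ioo_subset_Icc_self hx))
  refine ⟨hmem.toLp V, fun φ h1 h2 h3 => ?_⟩
  have hd : Continuous (deriv φ) := h1.continuous_deriv (by simp)
  have hφ1 : φ 1 = 0 := image_eq_zero_of_notMem_tsupport fun h => by simpa using h3 h
  have hdi : Integrable (deriv φ) μ := (hd.integrable_of_hasCompactSupport h2.deriv).restrict
  have hVx : ∀ x ∈ Ioo (0 : ℝ) 1, V x = ∫ y, (Iio x).indicator v y ∂μ := by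
    intro x hx
    rw [hVdef]
    simp only
    rw [intervalIntegral.integral_of_le hx.1.le, integral_Ioc_eq_integral_Ioo,
      setIntegral_indicator measurableSet_Ioo, integral_indicator measurableSet_Iio, hμ,
      Measure.restrict_restrict measurableSet_Iio]
    congr 2
    ext y
    simp only [mem_inter_iff, mem_Ioo, mem_Iio]
    have := hx.2
    constructor <;> intro h <;> constructor <;> grind
  have hprod : Integrable (fun q : ℝ × ℝ =>
      {q : ℝ × ℝ | q.2 < q.1}.indicator (fun q => deriv φ q.1 • v q.2) q) (μ.prod μ) :=
    (hdi.smul_prod hv).indicator (measurableSet_lt measurable_snd measurable_fst)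
  have hin : ∀ y ∈ Ioo (0 : ℝ) 1, ∫ x in Ioo (0 : ℝ) 1, (Ioi y).indicator (deriv φ) x = - φ y := by
    intro y hy
    rw [setIntegral_indicator measurableSet_Ioi]
    have : Ioo (0 : ℝ) 1 ∩ Ioi y = Ioo y 1 := by
      ext x
      simp only [mem_inter_iff, mem_Ioo, mem_Ioi]
      have := hy.1
      constructor <;> intro h <;> constructor <;> grind
    rw [this, ← integral_Ioc_eq_integral_Ioo, ← intervalIntegral.integral_of_le hy.2.le,
      intervalIntegral.integral_deriv_eq_sub
        (fun x _ => (h1.differentiable (by simp)).differentiableAt)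
        (hd.intervalIntegrable _ _), hφ1, zero_sub]
  calc ∫ x, deriv φ x • (hmem.toLp V) x ∂μ
      = ∫ x, ∫ y, {q : ℝ × ℝ | q.2 < q.1}.indicator (fun q => deriv φ q.1 • v q.2) (x, y) ∂μ ∂μ := by
        refine integral_congr_ae ?_
        filter_upwards [hmem.coeFn_toLp, ae_restrict_mem measurableSet_Ioo] with x e hx
        rw [e, hVx x hx, ← integral_smul]
        refine integral_congr_ae (Filter.Eventually.of_forall fun y => ?_)
        by_cases h : y < x <;> simp [indicator, h]
    _ = ∫ y, ∫ x, {q : ℝ × ℝ | q.2 < q.1}.indicator (fun q => deriv φ q.1 • v q.2) (x, y) ∂μ ∂μ :=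
        integral_integral_swap hprod
    _ = ∫ y, -(φ y • v y) ∂μ := by
        refine integral_congr_ae ?_
        filter_upwards [ae_restrict_mem measurableSet_Ioo] with y hy
        rw [← neg_smul, ← hin y hy, ← integral_smul_const]
        refine integral_congr_ae (Filter.Eventually.of_forall fun x => ?_)
        by_cases h : y < x <;> simp [indicator, h]
    _ = -∫ y, φ y • v y ∂μ := integral_neg _

/-! ### Spectrum of an unbounded operator -/

/-- The resolvent set of an unbounded operator `T`: those `z` for which `z - T : D(T) → E` has a
bounded everywhere defined inverse. -/
def resolventSetPMap {E : Type*} [NormedAddCommGroup E] [NormedSpace ℂ E] (T : E →ₗ.[ℂ] E) :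
    Set ℂ :=
  {z | ∃ S : E →L[ℂ] E,
    (∀ y : E, ∃ h : S y ∈ T.domain, z • S y - T ⟨S y, h⟩ = y) ∧
    ∀ x : T.domain, S (z • (x : E) - T x) = x}

/-- The spectrum of an unbounded operator, the complement of its resolvent set. -/
def spectrumPMap {E : Type*} [NormedAddCommGroup E] [NormedSpace ℂ E] (T : E →ₗ.[ℂ] E) : Set ℂ :=
  (resolventSetPMap T)ᶜ

/-- The region `{z : |Im z| > R, 0 < -Re z < H}`. -/
def stripRegion (H R : ℝ) : Set ℂ := {z | R < |z.im| ∧ 0 < -z.re ∧ -z.re < H}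

end ViscoWave

end

open ViscoWave

noncomputable section

namespace ViscoWave

open Filter Topology
open scoped ENNReal

variable {μ ν : Measure ℝ}

/-! ### The representing measure and the impedance as a Stieltjes transform -/

/-! Write `K` for the Stieltjes transform of `ν` on `(0, ∞)`. It equals the impedance on the closed
right half-plane (Fubini) and continues it to all non-real points. In the resolvent equation for
`-𝒜` at a non-real `z`, the memory component is solved pointwise, `ψ = (h + Γp) / (z + τ)`.
Integrating it turns the boundary condition into `v·n = K(z) Γp` plus data. The Riemann invariants
`p + v` and `p - v` satisfy scalar equations with exponential solutions, so what remains is a 2×2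
linear system. Its determinant is, up to a nonvanishing factor, `e^{2z}(1+K)² - (1-K)²`. Hence off
the real axis the spectrum is the zero set of `characteristicFn` (`spectrum_iff_characteristicFn`).

Where `K` is small, the zeros are the solutions of `z = iπn - log((1+K(z))/(1-K(z)))` for some
integer `n`. By dominated convergence `K` and its Lipschitz constant tend to zero as `|Im z|` grows
in a strip. So the right side is a contraction of the unit disc about `iπn`, and each zero far up in
the strip lies in such a disc (`exists_characteristicFn_zeros`).

The delicate point is that the errors are relative to `Re k̂` and to `Im k̂` separately; `Re k̂(iy)`
may be much smaller than `|k̂(iy)|²`. Two facts give this. The remainder of the odd, real function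
`log((1+w)/(1-w)) - 2w` has real part of size `|w|² |Re w|`, and likewise for imaginary parts.
Moreover `Re K(z) - Re K(iy)` is controlled by `|Re z|` and by a small multiple of `Re K(iy)`; since
`Re z` is itself comparable to `Re K(z)`, the first term can be absorbed
(`rootMap_fixed_asymptotics`). -/

theorem IsCompletelyMonotonic.sigmaFinite {k : ℝ → ℝ} {ν : Measure ℝ}
    (hk : IsCompletelyMonotonic k ν) : SigmaFinite (ν.restrict (Ici 0)) := by
  have h1 := (hk.integrable 1 one_pos)
  set μ := ν.restrict (Ici (0 : ℝ))
  have hf : Measurable fun τ : ℝ => ENNReal.ofReal (Real.exp (-(τ * 1))) := by fun_prop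
  -- The density `e^{-τ}` makes the measure finite; multiplying back by `e^{τ}` recovers it as a
  -- σ-finite measure.
  have : IsFiniteMeasure (μ.withDensity fun τ : ℝ => ENNReal.ofReal (Real.exp (-(τ * 1)))) :=
    isFiniteMeasure_withDensity_ofReal h1.2
  have h2 := withDensity_inv_same (μ := μ) hf
    (Eventually.of_forall fun τ => by simp [Real.exp_pos])
    (Eventually.of_forall fun τ => by simp)
  rw [← h2]
  have e : (fun τ : ℝ => (ENNReal.ofReal (Real.exp (-(τ * 1))))⁻¹)
      = fun τ => ENNReal.ofReal (Real.exp (τ * 1)) := by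
    ext τ
    rw [← ENNReal.ofReal_inv_of_pos (Real.exp_pos _), Real.exp_neg, inv_inv]
  rw [e]
  exact SigmaFinite.withDensity_ofReal _

theorem IsCompletelyMonotonic.integrable_prod {k : ℝ → ℝ} {ν : Measure ℝ}
    (hk : IsCompletelyMonotonic k ν) (hint : IntegrableOn k (Ioi 0)) :
    Integrable (fun q : ℝ × ℝ => Real.exp (-(q.2 * q.1)))
      ((volume.restrict (Ioi 0)).prod (ν.restrict (Ici 0))) := by
  have := hk.sigmaFinite
  rw [integrable_prod_iff (by fun_prop)]
  refine ⟨(ae_restrict_iff' measurableSet_Ioi).2 (Eventually.of_forall fun t ht =>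
    hk.integrable t ht), ?_⟩
  refine Integrable.congr hint ?_
  filter_upwards [ae_restrict_mem measurableSet_Ioi] with t ht
  rw [hk.eq_integral t ht]
  refine integral_congr_ae (Eventually.of_forall fun τ => ?_)
  simp

/-- The double integral of `e^{-τt}` is finite because `k` is integrable. Integrating in `t` first
gives `1/τ`, so `1/τ` is integrable, and an atom at `τ = 0` would make the inner integral diverge.
-/
theorem IsCompletelyMonotonic.ae_integrableOn {k : ℝ → ℝ} {ν : Measure ℝ}
    (hk : IsCompletelyMonotonic k ν) (hint : IntegrableOn k (Ioi 0)) :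
    (∀ᵐ τ ∂(ν.restrict (Ici 0)), 0 < τ) ∧ Integrable (fun τ : ℝ => τ⁻¹) (ν.restrict (Ici 0)) := by
  have := hk.sigmaFinite
  have h := (integrable_prod_iff' (by fun_prop)).1 (hk.integrable_prod hint)
  have h1 : ∀ᵐ τ ∂(ν.restrict (Ici 0)), 0 < τ := by
    filter_upwards [h.1, ae_restrict_mem measurableSet_Ici] with τ h1 h2
    refine lt_of_le_of_ne h2 ?_
    rintro rfl
    simp [integrable_const_iff, isFiniteMeasure_restrict] at h1
  refine ⟨h1, h.2.congr ?_⟩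
  filter_upwards [h1] with τ hτ
  have e := integral_exp_mul_Ioi (a := -τ) (by linarith) 0
  simp only [Real.norm_eq_abs, Real.abs_exp]
  simp only [neg_mul] at e
  rw [e]
  field_simp
  simp

theorem IsCompletelyMonotonic.restrict_Ici_eq {k : ℝ → ℝ} {ν : Measure ℝ}
    (hk : IsCompletelyMonotonic k ν) (hint : IntegrableOn k (Ioi 0)) :
    ν.restrict (Ici 0) = ν.restrict (Ioi 0) := by
  have h := (hk.ae_integrableOn hint).1
  have e : Ioi (0 : ℝ) ∩ Ici 0 = Ioi 0 := inter_eq_left.2 Ioi_subset_Ici_self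
  conv_rhs => rw [← e]
  rw [← Measure.restrict_restrict measurableSet_Ioi]
  exact (Measure.restrict_eq_self_of_ae_mem h).symm

/-- The Stieltjes transform `∫ dμ(τ) / (z + τ)` of a measure. -/
def stieltjes (μ : Measure ℝ) (z : ℂ) : ℂ := ∫ τ, (z + (τ : ℂ))⁻¹ ∂μ

/-- Fubini, with `|e^{-zt}| ≤ 1` for `Re z ≥ 0`. The eigenvalues have negative real part, and there
only the Stieltjes transform is used. -/
theorem IsCompletelyMonotonic.impedance_eq {k : ℝ → ℝ} {ν : Measure ℝ}
    (hk : IsCompletelyMonotonic k ν) (hint : IntegrableOn k (Ioi 0)) {z : ℂ} (hz : 0 ≤ z.re) :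
    impedance k z = stieltjes (ν.restrict (Ioi 0)) z := by
  have := hk.sigmaFinite
  have hF : Integrable (fun q : ℝ × ℝ => Complex.exp (-(z * (q.1 : ℂ)))
      * ((Real.exp (-(q.2 * q.1)) : ℝ) : ℂ))
      ((volume.restrict (Ioi 0)).prod (ν.restrict (Ici 0))) := by
    refine (hk.integrable_prod hint).ofReal.bdd_mul (c := 1) (by fun_prop) ?_
    have h1 : ∀ᵐ t ∂(volume.restrict (Ioi (0 : ℝ))), t ∈ Ioi (0 : ℝ) :=
      ae_restrict_mem measurableSet_Ioi
    have h2 := (Measure.quasiMeasurePreserving_fst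
      (μ := volume.restrict (Ioi (0 : ℝ))) (ν := ν.restrict (Ici 0))).ae h1
    filter_upwards [h2] with q hq
    rw [Complex.norm_exp, Real.exp_le_one_iff]
    have : (0 : ℝ) < q.1 := hq
    simp only [Complex.neg_re, Complex.mul_re, Complex.ofReal_re, Complex.ofReal_im]
    nlinarith [mul_nonneg hz this.le]
  rw [← hk.restrict_Ici_eq hint, stieltjes, impedance]
  calc ∫ t in Ioi (0 : ℝ), Complex.exp (-(z * (t : ℂ))) * (k t : ℂ)
      = ∫ t in Ioi (0 : ℝ), ∫ τ in Ici (0 : ℝ), Complex.exp (-(z * (t : ℂ)))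
          * ((Real.exp (-(τ * t)) : ℝ) : ℂ) ∂ν := by
        refine integral_congr_ae ?_
        filter_upwards [ae_restrict_mem measurableSet_Ioi] with t ht
        rw [hk.eq_integral t ht, integral_const_mul, integral_complex_ofReal]
    _ = ∫ τ in Ici (0 : ℝ), ∫ t in Ioi (0 : ℝ), Complex.exp (-(z * (t : ℂ)))
          * ((Real.exp (-(τ * t)) : ℝ) : ℂ) ∂volume ∂ν := integral_integral_swap hF
    _ = ∫ τ in Ici (0 : ℝ), (z + (τ : ℂ))⁻¹ ∂ν := by
        refine integral_congr_ae ?_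
        filter_upwards [(hk.ae_integrableOn hint).1] with τ hτ
        have e := integral_exp_mul_complex_Ioi (a := -(z + τ)) (by simp; linarith) 0
        have e2 : ∀ t : ℝ, Complex.exp (-(z * (t : ℂ))) * ((Real.exp (-(τ * t)) : ℝ) : ℂ)
            = Complex.exp (-(z + τ) * t) := by
          intro t
          push_cast
          rw [← Complex.exp_add]
          ring_nf
        simp only [e2]
        rw [e]
        rw [neg_div_neg_eq]
        simp

theorem IsCompletelyMonotonic.restrict_ne_zero {k : ℝ → ℝ} {ν : Measure ℝ}
    (hk : IsCompletelyMonotonic k ν) (hint : IntegrableOn k (Ioi 0))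
    (hne : ∃ t : ℝ, 0 < t ∧ k t ≠ 0) : ν.restrict (Ioi 0) ≠ 0 := by
  intro h
  obtain ⟨t, ht, hkt⟩ := hne
  rw [hk.eq_integral t ht, hk.restrict_Ici_eq hint, h] at hkt
  simp at hkt

/-! ### Estimates for the Stieltjes transform near the imaginary axis -/

theorem abs_im_le_norm_add (z : ℂ) (τ : ℝ) : |z.im| ≤ ‖z + τ‖ := by
  simpa using Complex.abs_im_le_norm (z + τ)

theorem add_ofReal_ne_zero {z : ℂ} (hz : z.im ≠ 0) (τ : ℝ) : z + τ ≠ 0 :=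
  norm_pos_iff.1 ((abs_pos.2 hz).trans_le (abs_im_le_norm_add z τ))

/-- From `τ ≤ |z + τ| + |z|` and `|z| ≤ |z + τ| · |z| / |Im z|`. This makes `1/τ` a dominating
function at every non-real `z`. -/
theorem norm_inv_add_le {z : ℂ} (hz : z.im ≠ 0) {τ : ℝ} (hτ : 0 < τ) :
    ‖(z + τ)⁻¹‖ ≤ (1 + ‖z‖ / |z.im|) * τ⁻¹ := by
  have h0 := abs_pos.2 hz
  have h1 := abs_im_le_norm_add z τ
  have h2 : τ ≤ ‖z + τ‖ * (1 + ‖z‖ / |z.im|) := by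
    have h3 : τ ≤ ‖z + τ‖ + ‖z‖ := by
      have := norm_sub_le (z + τ) z
      rwa [add_sub_cancel_left, Complex.norm_real, Real.norm_of_nonneg hτ.le] at this
    have h4 : ‖z‖ ≤ ‖z + τ‖ * (‖z‖ / |z.im|) := by
      rw [← mul_div_assoc, le_div_iff₀ h0]
      nlinarith [norm_nonneg z]
    linarith
  rw [norm_inv, inv_eq_one_div, ← div_eq_mul_inv, div_le_div_iff₀ (h0.trans_le h1) hτ]
  linarith

theorem norm_inv_add_le_inv_abs_im {z : ℂ} (hz : z.im ≠ 0) (τ : ℝ) :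
    ‖(z + τ)⁻¹‖ ≤ |z.im|⁻¹ := by
  rw [norm_inv]
  exact inv_anti₀ (abs_pos.2 hz) (abs_im_le_norm_add z τ)

theorem sq_norm_I_mul_add (y τ : ℝ) : ‖Complex.I * y + τ‖ ^ 2 = τ ^ 2 + y ^ 2 := by
  rw [← Complex.normSq_eq_norm_sq, Complex.normSq_apply]
  simp
  ring

/-- Since `|y| ≤ |iy + τ|`, moving from `iy` to `z` changes the denominator by at most half its
size, uniformly in `τ`. -/
theorem half_norm_le {z : ℂ} {y : ℝ} (h : ‖z - Complex.I * y‖ ≤ |y| / 2) (τ : ℝ) :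
    ‖Complex.I * y + τ‖ / 2 ≤ ‖z + τ‖ := by
  have h1 : |y| ≤ ‖Complex.I * y + τ‖ := by simpa using abs_im_le_norm_add (Complex.I * y) τ
  have h2 : ‖Complex.I * y + τ‖ ≤ ‖z + τ‖ + ‖z - Complex.I * y‖ := by
    have := norm_sub_le (z + τ) (z - Complex.I * y)
    rwa [show z + τ - (z - Complex.I * y) = Complex.I * y + τ by ring] at this
  linarith

theorem norm_inv_le_two_mul {z : ℂ} {y : ℝ} (hy : y ≠ 0) (h : ‖z - Complex.I * y‖ ≤ |y| / 2)
    (τ : ℝ) : ‖(z + τ)⁻¹‖ ≤ 2 * ‖(Complex.I * y + τ)⁻¹‖ := by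
  have h1 : 0 < ‖Complex.I * y + τ‖ := norm_pos_iff.2 (add_ofReal_ne_zero (by simpa) τ)
  have h2 := half_norm_le h τ
  rw [norm_inv, norm_inv, ← div_eq_mul_inv, ← inv_div]
  exact inv_anti₀ (by positivity) h2

theorem im_ne_zero_of_near {z : ℂ} {y : ℝ} (hy : y ≠ 0) (h : ‖z - Complex.I * y‖ ≤ |y| / 2) :
    z.im ≠ 0 := by
  intro h0
  have := (Complex.abs_im_le_norm (z - Complex.I * y)).trans h
  have h1 := abs_pos.2 hy
  simp [h0] at this
  linarith

/-- With `a = |iy + τ|` and `b = |z + τ|`, the difference of real parts is `Re z / b² + τ (1/b² -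
1/a²)`. The second term is small relative to `τ/a²`, the real part at `iy`; a bound by the modulus
of the difference would lose this. The constants come from `a/2 ≤ b ≤ 3a/2`. -/
theorem abs_re_diff_le {z : ℂ} {y : ℝ} (hy : y ≠ 0) (h : ‖z - Complex.I * y‖ ≤ |y| / 2)
    {τ : ℝ} (hτ : 0 < τ) :
    |((z + τ)⁻¹ - (Complex.I * y + τ)⁻¹).re| ≤ 4 * |z.re| * (τ ^ 2 + y ^ 2)⁻¹
      + 10 * ‖z - Complex.I * y‖ / |y| * (τ / (τ ^ 2 + y ^ 2)) := by
  have hy0 := abs_pos.2 hy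
  have ha : |y| ≤ ‖Complex.I * y + τ‖ := by simpa using abs_im_le_norm_add (Complex.I * y) τ
  have hb := half_norm_le h τ
  have hc : |‖Complex.I * y + τ‖ - ‖z + τ‖| ≤ ‖z - Complex.I * y‖ := by
    have := abs_norm_sub_norm_le (Complex.I * y + τ) (z + τ)
    rwa [add_sub_add_right_eq_sub, norm_sub_rev] at this
  have hs := sq_norm_I_mul_add y τ
  rw [← hs, Complex.sub_re, Complex.inv_re, Complex.inv_re, Complex.normSq_eq_norm_sq,
    Complex.normSq_eq_norm_sq]
  set a := ‖Complex.I * y + τ‖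
  set b := ‖z + τ‖
  set d := ‖z - Complex.I * y‖
  have hd : 0 ≤ d := norm_nonneg _
  have ha0 : 0 < a := hy0.trans_le ha
  have hb0 : 0 < b := by linarith
  have e : (z + (τ : ℂ)).re / b ^ 2 - (Complex.I * y + (τ : ℂ)).re / a ^ 2
      = z.re / b ^ 2 + τ * (a ^ 2 - b ^ 2) / (a ^ 2 * b ^ 2) := by
    simp
    field_simp
    ring
  rw [e]
  have hbi : (b ^ 2)⁻¹ ≤ 4 * (a ^ 2)⁻¹ := by
    have : a ^ 2 / 4 ≤ b ^ 2 := by nlinarith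
    have := inv_anti₀ (by positivity) this
    rwa [inv_div, div_eq_mul_inv] at this
  have hab : |a ^ 2 - b ^ 2| ≤ d * (5 / 2 * a) := by
    rw [sq_sub_sq, mul_comm, abs_mul]
    have : b ≤ 3 / 2 * a := by
      have := (abs_le.1 hc).1
      linarith
    refine mul_le_mul hc ?_ (abs_nonneg _) hd
    rw [abs_of_pos (by linarith)]
    linarith
  refine (abs_add_le _ _).trans (add_le_add ?_ ?_)
  · rw [abs_div, abs_of_pos (pow_pos hb0 2), div_eq_mul_inv]
    calc |z.re| * (b ^ 2)⁻¹ ≤ |z.re| * (4 * (a ^ 2)⁻¹) := by gcongr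
      _ = _ := by ring
  · rw [abs_div, abs_mul, abs_of_pos hτ, abs_of_pos (by positivity : 0 < a ^ 2 * b ^ 2)]
    calc τ * |a ^ 2 - b ^ 2| / (a ^ 2 * b ^ 2)
        = τ * |a ^ 2 - b ^ 2| * (a ^ 2)⁻¹ * (b ^ 2)⁻¹ := by field_simp
      _ ≤ τ * (d * (5 / 2 * a)) * (a ^ 2)⁻¹ * (4 * (a ^ 2)⁻¹) := by gcongr
      _ = 10 * d / a * (τ / a ^ 2) := by field_simp; ring
      _ ≤ 10 * d / |y| * (τ / a ^ 2) := by gcongr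

theorem integrable_inv_add (hpos : ∀ᵐ τ ∂μ, 0 < τ) (hinv : Integrable (fun τ : ℝ => τ⁻¹) μ)
    {z : ℂ} (hz : z.im ≠ 0) : Integrable (fun τ : ℝ => (z + (τ : ℂ))⁻¹) μ := by
  refine (hinv.const_mul (1 + ‖z‖ / |z.im|)).mono' (by fun_prop) ?_
  filter_upwards [hpos] with τ hτ using norm_inv_add_le hz hτ

theorem integrable_inv_sq_add_sq (hpos : ∀ᵐ τ ∂μ, 0 < τ)
    (hinv : Integrable (fun τ : ℝ => τ⁻¹) μ) {y : ℝ} (hy : y ≠ 0) :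
    Integrable (fun τ : ℝ => (τ ^ 2 + y ^ 2)⁻¹) μ := by
  refine (hinv.mul_const |y|⁻¹).mono' (by fun_prop) ?_
  filter_upwards [hpos] with τ hτ
  have := abs_pos.2 hy
  rw [Real.norm_of_nonneg (by positivity), ← mul_inv]
  refine inv_anti₀ (by positivity) ?_
  nlinarith [sq_nonneg (τ - |y|), sq_abs y]

theorem integrable_div_sq_add_sq (hpos : ∀ᵐ τ ∂μ, 0 < τ)
    (hinv : Integrable (fun τ : ℝ => τ⁻¹) μ) (y : ℝ) :
    Integrable (fun τ : ℝ => τ / (τ ^ 2 + y ^ 2)) μ := by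
  refine hinv.mono' (Measurable.aestronglyMeasurable (by fun_prop)) ?_
  filter_upwards [hpos] with τ hτ
  rw [Real.norm_of_nonneg (by positivity), inv_eq_one_div, div_le_div_iff₀ (by positivity) hτ]
  nlinarith [sq_nonneg y]

theorem stieltjes_I_mul_re (hpos : ∀ᵐ τ ∂μ, 0 < τ) (hinv : Integrable (fun τ : ℝ => τ⁻¹) μ)
    {y : ℝ} (hy : y ≠ 0) :
    (stieltjes μ (Complex.I * y)).re = ∫ τ, τ / (τ ^ 2 + y ^ 2) ∂μ := by
  rw [stieltjes, ← RCLike.re_to_complex,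
    ← integral_re (integrable_inv_add hpos hinv (by simpa))]
  refine integral_congr_ae (Eventually.of_forall fun τ => ?_)
  simp only [RCLike.re_to_complex]
  rw [Complex.inv_re, Complex.normSq_eq_norm_sq, sq_norm_I_mul_add]
  simp

theorem stieltjes_I_mul_im (hpos : ∀ᵐ τ ∂μ, 0 < τ) (hinv : Integrable (fun τ : ℝ => τ⁻¹) μ)
    {y : ℝ} (hy : y ≠ 0) :
    (stieltjes μ (Complex.I * y)).im = -(y * ∫ τ, (τ ^ 2 + y ^ 2)⁻¹ ∂μ) := by
  rw [stieltjes, ← RCLike.im_to_complex,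
    ← integral_im (integrable_inv_add hpos hinv (by simpa)), ← integral_const_mul, ← integral_neg]
  refine integral_congr_ae (Eventually.of_forall fun τ => ?_)
  simp only [RCLike.im_to_complex]
  rw [Complex.inv_im, Complex.normSq_eq_norm_sq, sq_norm_I_mul_add]
  simp [div_eq_mul_inv]

theorem integral_pos_of_ae_pos {f : ℝ → ℝ} (hμ : μ ≠ 0) (hf : Integrable f μ)
    (h : ∀ᵐ τ ∂μ, 0 < f τ) : 0 < ∫ τ, f τ ∂μ := by
  have h0 : 0 ≤ᵐ[μ] f := h.mono fun _ => le_of_lt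
  refine lt_of_le_of_ne (integral_nonneg_of_ae h0) fun e => hμ ?_
  have h1 := (integral_eq_zero_iff_of_nonneg_ae h0 hf).1 e.symm
  rw [← ae_eq_bot, ← eventually_false_iff_eq_bot]
  filter_upwards [h, h1] with τ a b
  simp [b] at a

theorem integral_inv_sq_pos (hpos : ∀ᵐ τ ∂μ, 0 < τ) (hinv : Integrable (fun τ : ℝ => τ⁻¹) μ)
    (hμ : μ ≠ 0) {y : ℝ} (hy : y ≠ 0) : 0 < ∫ τ, (τ ^ 2 + y ^ 2)⁻¹ ∂μ := by
  refine integral_pos_of_ae_pos hμ (integrable_inv_sq_add_sq hpos hinv hy) ?_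
  filter_upwards [hpos] with τ hτ
  positivity

theorem stieltjes_I_mul_re_pos (hpos : ∀ᵐ τ ∂μ, 0 < τ)
    (hinv : Integrable (fun τ : ℝ => τ⁻¹) μ) (hμ : μ ≠ 0) {y : ℝ} (hy : y ≠ 0) :
    0 < (stieltjes μ (Complex.I * y)).re := by
  rw [stieltjes_I_mul_re hpos hinv hy]
  refine integral_pos_of_ae_pos hμ (integrable_div_sq_add_sq hpos hinv y) ?_
  filter_upwards [hpos] with τ hτ
  positivity

theorem norm_stieltjes_le (hpos : ∀ᵐ τ ∂μ, 0 < τ) (hinv : Integrable (fun τ : ℝ => τ⁻¹) μ)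
    {z : ℂ} {y : ℝ} (hy : y ≠ 0) (h : ‖z - Complex.I * y‖ ≤ |y| / 2) :
    ‖stieltjes μ z‖ ≤ 2 * ∫ τ, ‖(Complex.I * y + (τ : ℂ))⁻¹‖ ∂μ := by
  rw [stieltjes, ← integral_const_mul]
  refine norm_integral_le_of_norm_le
    ((integrable_inv_add hpos hinv (by simpa)).norm.const_mul 2)
    (Eventually.of_forall fun τ => norm_inv_le_two_mul hy h τ)

theorem integral_inv_sq_le (hpos : ∀ᵐ τ ∂μ, 0 < τ) (hinv : Integrable (fun τ : ℝ => τ⁻¹) μ)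
    {y : ℝ} (hy : 1 ≤ |y|) :
    ∫ τ, (τ ^ 2 + y ^ 2)⁻¹ ∂μ ≤ ∫ τ, ‖(Complex.I * y + (τ : ℂ))⁻¹‖ ∂μ := by
  have hy0 : y ≠ 0 := by
    rintro rfl
    norm_num at hy
  refine integral_mono (integrable_inv_sq_add_sq hpos hinv hy0)
    (integrable_inv_add hpos hinv (by simpa)).norm fun τ => ?_
  have h1 : |y| ≤ ‖Complex.I * y + τ‖ := by simpa using abs_im_le_norm_add (Complex.I * y) τ
  simp only [← sq_norm_I_mul_add, norm_inv]
  refine inv_anti₀ (by linarith) ?_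
  nlinarith

/-- Resolvent identity for the integrands, each factor costing 2 when its denominator is compared
with `|iy + τ|`. -/
theorem norm_stieltjes_sub_le (hpos : ∀ᵐ τ ∂μ, 0 < τ)
    (hinv : Integrable (fun τ : ℝ => τ⁻¹) μ) {z w : ℂ} {y : ℝ} (hy : y ≠ 0)
    (hz : ‖z - Complex.I * y‖ ≤ |y| / 2) (hw : ‖w - Complex.I * y‖ ≤ |y| / 2) :
    ‖stieltjes μ z - stieltjes μ w‖ ≤ 4 * ‖z - w‖ * ∫ τ, (τ ^ 2 + y ^ 2)⁻¹ ∂μ := by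
  have hz0 := im_ne_zero_of_near hy hz
  have hw0 := im_ne_zero_of_near hy hw
  rw [stieltjes, stieltjes, ← integral_sub (integrable_inv_add hpos hinv hz0)
    (integrable_inv_add hpos hinv hw0), ← integral_const_mul]
  refine norm_integral_le_of_norm_le ((integrable_inv_sq_add_sq hpos hinv hy).const_mul _)
    (Eventually.of_forall fun τ => ?_)
  have h1 := add_ofReal_ne_zero hz0 τ
  have h2 := add_ofReal_ne_zero hw0 τ
  rw [show (z + (τ : ℂ))⁻¹ - (w + τ)⁻¹ = -(z - w) * (z + τ)⁻¹ * (w + τ)⁻¹ by field_simp; ring,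
    norm_mul, norm_mul, norm_neg]
  calc ‖z - w‖ * ‖(z + (τ : ℂ))⁻¹‖ * ‖(w + (τ : ℂ))⁻¹‖
      ≤ ‖z - w‖ * (2 * ‖(Complex.I * y + (τ : ℂ))⁻¹‖) * (2 * ‖(Complex.I * y + (τ : ℂ))⁻¹‖) := by
        gcongr
        · exact norm_inv_le_two_mul hy hz τ
        · exact norm_inv_le_two_mul hy hw τ
    _ = 4 * ‖z - w‖ * (‖Complex.I * y + (τ : ℂ)‖ ^ 2)⁻¹ := by rw [norm_inv]; ring
    _ = _ := by rw [sq_norm_I_mul_add]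

theorem abs_re_stieltjes_sub_le (hpos : ∀ᵐ τ ∂μ, 0 < τ)
    (hinv : Integrable (fun τ : ℝ => τ⁻¹) μ) {z : ℂ} {y : ℝ} (hy : y ≠ 0)
    (hz : ‖z - Complex.I * y‖ ≤ |y| / 2) :
    |(stieltjes μ z).re - (stieltjes μ (Complex.I * y)).re|
      ≤ 4 * |z.re| * ∫ τ, (τ ^ 2 + y ^ 2)⁻¹ ∂μ
        + 10 * ‖z - Complex.I * y‖ / |y| * (stieltjes μ (Complex.I * y)).re := by
  have h1 := integrable_inv_add hpos hinv (im_ne_zero_of_near hy hz)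
  have h2 : Integrable (fun τ : ℝ => (Complex.I * y + (τ : ℂ))⁻¹) μ :=
    integrable_inv_add hpos hinv (by simpa)
  have e := integral_re (h1.sub h2)
  simp only [Pi.sub_apply] at e
  rw [stieltjes_I_mul_re hpos hinv hy, ← integral_const_mul, ← integral_const_mul,
    ← integral_add ((integrable_inv_sq_add_sq hpos hinv hy).const_mul _)
      ((integrable_div_sq_add_sq hpos hinv y).const_mul _),
    ← stieltjes_I_mul_re hpos hinv hy, ← Complex.sub_re, stieltjes, stieltjes, ← integral_sub h1 h2,
    ← RCLike.re_to_complex, ← e, ← Real.norm_eq_abs]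
  refine norm_integral_le_of_norm_le (((integrable_inv_sq_add_sq hpos hinv hy).const_mul _).add
    ((integrable_div_sq_add_sq hpos hinv y).const_mul _)) ?_
  filter_upwards [hpos] with τ hτ
  exact abs_re_diff_le hy hz hτ

theorem stieltjes_conj (z : ℂ) :
    stieltjes μ ((starRingEnd ℂ) z) = (starRingEnd ℂ) (stieltjes μ z) := by
  rw [stieltjes, stieltjes, ← integral_conj]
  refine integral_congr_ae (Eventually.of_forall fun τ => ?_)
  simp

theorem exists_forall_integral_norm_inv_lt (hpos : ∀ᵐ τ ∂μ, 0 < τ)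
    (hinv : Integrable (fun τ : ℝ => τ⁻¹) μ) {ε : ℝ} (hε : 0 < ε) :
    ∃ Y : ℝ, ∀ y : ℝ, Y ≤ |y| → ∫ τ, ‖(Complex.I * y + (τ : ℂ))⁻¹‖ ∂μ < ε := by
  -- The pulled-back filter treats `y → ∞` and `y → -∞` together.
  have hl : Tendsto (fun y : ℝ => |y|) (comap (fun y : ℝ => |y|) atTop) atTop := tendsto_comap
  have h : Tendsto (fun y : ℝ => ∫ τ, ‖(Complex.I * y + (τ : ℂ))⁻¹‖ ∂μ)
      (comap (fun y : ℝ => |y|) atTop) (𝓝 (∫ _, (0 : ℝ) ∂μ)) := by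
    refine tendsto_integral_filter_of_dominated_convergence (fun τ => τ⁻¹)
      (Eventually.of_forall fun y => by fun_prop) (Eventually.of_forall fun y => ?_) hinv
      (Eventually.of_forall fun τ => ?_)
    · filter_upwards [hpos] with τ hτ
      rw [norm_norm, norm_inv]
      refine inv_anti₀ hτ ?_
      have := Complex.abs_re_le_norm (Complex.I * y + τ)
      simp only [Complex.add_re, Complex.mul_re, Complex.I_re, Complex.ofReal_re, Complex.I_im,
        Complex.ofReal_im, zero_mul, mul_zero, sub_zero, zero_add] at this
      rwa [abs_of_pos hτ] at this
    · simp only [norm_inv]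
      refine (tendsto_atTop_mono (fun y => ?_) hl).inv_tendsto_atTop
      simpa using abs_im_le_norm_add (Complex.I * y) τ
  rw [integral_zero] at h
  have h1 := h.eventually (gt_mem_nhds hε)
  rw [eventually_comap] at h1
  obtain ⟨Y, hY⟩ := eventually_atTop.1 h1
  exact ⟨Y, fun y hy => hY _ hy y rfl⟩

/-! ### The function `log ((1 + w) / (1 - w))` -/

/-- The branch of `log ((1 + w) / (1 - w))` that vanishes at `w = 0`. -/
def logRatio (w : ℂ) : ℂ := Complex.log (1 + w) - Complex.log (1 - w)

theorem one_add_mem_slitPlane {w : ℂ} (hw : ‖w‖ ≤ 1 / 2) : 1 + w ∈ Complex.slitPlane :=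
  Complex.mem_slitPlane_of_norm_lt_one (by linarith)

theorem one_sub_mem_slitPlane {w : ℂ} (hw : ‖w‖ ≤ 1 / 2) : 1 - w ∈ Complex.slitPlane := by
  rw [sub_eq_add_neg]
  exact one_add_mem_slitPlane (by rwa [norm_neg])

theorem exp_logRatio {w : ℂ} (hw : ‖w‖ ≤ 1 / 2) :
    Complex.exp (logRatio w) = (1 + w) / (1 - w) := by
  rw [logRatio, Complex.exp_sub,
    Complex.exp_log (Complex.slitPlane_ne_zero (one_add_mem_slitPlane hw)),
    Complex.exp_log (Complex.slitPlane_ne_zero (one_sub_mem_slitPlane hw))]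

theorem logRatio_conj {w : ℂ} (hw : ‖w‖ ≤ 1 / 2) :
    logRatio ((starRingEnd ℂ) w) = (starRingEnd ℂ) (logRatio w) := by
  have h1 := Complex.log_conj _ (Complex.slitPlane_arg_ne_pi (one_add_mem_slitPlane hw))
  have h2 := Complex.log_conj _ (Complex.slitPlane_arg_ne_pi (one_sub_mem_slitPlane hw))
  simp only [map_add, map_sub, map_one] at h1 h2
  rw [logRatio, h1, h2, logRatio, map_sub]

theorem three_quarters_le_norm_one_sub_sq {w : ℂ} (hw : ‖w‖ ≤ 1 / 2) :
    3 / 4 ≤ ‖1 - w ^ 2‖ := by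
  have h1 := norm_sub_norm_le (1 : ℂ) (w ^ 2)
  rw [norm_one, norm_pow] at h1
  nlinarith [norm_nonneg w]

theorem hasDerivAt_logRatio {w : ℂ} (hw : ‖w‖ ≤ 1 / 2) :
    HasDerivAt logRatio (2 / (1 - w ^ 2)) w := by
  have h1 := one_add_mem_slitPlane hw
  have h2 := one_sub_mem_slitPlane hw
  have d1 := ((hasDerivAt_id w).const_add 1).clog h1
  have d2 := ((hasDerivAt_id w).const_sub 1).clog h2
  have e1 := Complex.slitPlane_ne_zero h1
  have e2 := Complex.slitPlane_ne_zero h2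
  have e3 : 1 - w ^ 2 ≠ 0 := by
    rw [show 1 - w ^ 2 = (1 + w) * (1 - w) by ring]
    exact mul_ne_zero e1 e2
  convert! d1.sub d2 using 1
  simp only [id]
  field_simp
  ring

/-- The derivative `2/(1 - w²)` is at most `8/3` on the disc of radius `1/2`. -/
theorem norm_logRatio_sub_le {w w' : ℂ} (hw : ‖w‖ ≤ 1 / 2) (hw' : ‖w'‖ ≤ 1 / 2) :
    ‖logRatio w - logRatio w'‖ ≤ 3 * ‖w - w'‖ := by
  refine (convex_closedBall (0 : ℂ) (1 / 2)).norm_image_sub_le_of_norm_hasDerivWithin_le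
    (f' := fun w => 2 / (1 - w ^ 2)) (fun x hx => ?_) (fun x hx => ?_)
    (by simpa using hw') (by simpa using hw)
  · exact (hasDerivAt_logRatio (by simpa using hx)).hasDerivWithinAt
  · have := three_quarters_le_norm_one_sub_sq (w := x) (by simpa using hx)
    rw [norm_div, div_le_iff₀ (by linarith)]
    norm_num
    linarith

theorem norm_logRatio_le {w : ℂ} (hw : ‖w‖ ≤ 1 / 2) : ‖logRatio w‖ ≤ 3 * ‖w‖ := by
  have := norm_logRatio_sub_le hw (w' := 0) (by simp)
  simpa [logRatio] using this

/-- Subtracting the linear term leaves a derivative along the segment from `0` to `w` that is cubic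
in `w`. -/
theorem hasDerivAt_logRatio_segment {w : ℂ} (hw : ‖w‖ ≤ 1 / 2) {t : ℝ} (ht : t ∈ Icc (0 : ℝ) 1) :
    ‖(t : ℂ) * w‖ ≤ 1 / 2 ∧ HasDerivAt (fun t : ℝ => logRatio (t * w) - 2 * (t * w))
      (2 * t ^ 2 * (w ^ 3 / (1 - (t * w) ^ 2))) t := by
  have h : ‖(t : ℂ) * w‖ ≤ 1 / 2 := by
    rw [norm_mul, Complex.norm_real, Real.norm_of_nonneg ht.1]
    nlinarith [ht.2, norm_nonneg w]
  refine ⟨h, ?_⟩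
  have h0 : (1 : ℂ) - (t * w) ^ 2 ≠ 0 := by
    have := three_quarters_le_norm_one_sub_sq h
    exact norm_pos_iff.1 (by linarith)
  have d0 : HasDerivAt (fun t : ℝ => (t : ℂ) * w) w t := by
    simpa using (Complex.ofRealCLM.hasDerivAt (x := t)).mul_const w
  have d1 := (hasDerivAt_logRatio h).comp_of_eq t d0 rfl
  have h1 : (1 : ℂ) - t ^ 2 * w ^ 2 ≠ 0 := by rwa [mul_pow] at h0
  convert! d1.sub (d0.const_mul 2) using 1
  simp only [mul_pow]
  field_simp
  ring

/-- After multiplication by the conjugate of the denominator the numerator is `w³ - t²|w|⁴ w`. Its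
real part is divisible by `Re w` and its imaginary part by `Im w`, so each part is bounded by its
own counterpart in `w`. -/
theorem cube_div_one_sub_sq_parts_le {w : ℂ} (hw : ‖w‖ ≤ 1 / 2) {t : ℝ} (ht : t ∈ Icc (0 : ℝ) 1) :
    |(w ^ 3 / (1 - (t * w) ^ 2)).re| ≤ 6 * ‖w‖ ^ 2 * |w.re| ∧
    |(w ^ 3 / (1 - (t * w) ^ 2)).im| ≤ 6 * ‖w‖ ^ 2 * |w.im| := by
  have h := (hasDerivAt_logRatio_segment hw ht).1
  have hq := three_quarters_le_norm_one_sub_sq h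
  set q : ℂ := 1 - (t * w) ^ 2 with hqdef
  have hN : 9 / 16 ≤ Complex.normSq q := by
    rw [Complex.normSq_eq_norm_sq]
    nlinarith
  have hNi : (Complex.normSq q)⁻¹ ≤ 16 / 9 := by
    have := inv_anti₀ (by norm_num) hN
    norm_num at this ⊢
    exact this
  have hr : ‖w‖ ^ 2 = w.re ^ 2 + w.im ^ 2 := by
    rw [← Complex.normSq_eq_norm_sq, Complex.normSq_apply]
    ring
  have hr1 : ‖w‖ ^ 2 ≤ 1 / 4 := by nlinarith [norm_nonneg w]
  have ht2 : t ^ 2 ≤ 1 := by nlinarith [ht.1, ht.2]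
  have ht0 := sq_nonneg t
  -- Here `13/4 = 3 + 1/4`: the cubic term contributes at most `3|w|²`, the other at most `|w|²/4`.
  -- Then `13/4 · 16/9 < 6`.
  have bound : ∀ c : ℝ, |c| ≤ 13 / 4 * ‖w‖ ^ 2 → ∀ u : ℝ,
      |u * c * (Complex.normSq q)⁻¹| ≤ 6 * ‖w‖ ^ 2 * |u| := by
    intro c hc u
    rw [abs_mul, abs_mul, abs_of_nonneg (inv_nonneg.2 (Complex.normSq_nonneg q))]
    calc |u| * |c| * (Complex.normSq q)⁻¹ ≤ |u| * (13 / 4 * ‖w‖ ^ 2) * (16 / 9) := by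
          gcongr
      _ ≤ 6 * ‖w‖ ^ 2 * |u| := by nlinarith [mul_nonneg (abs_nonneg u) (sq_nonneg ‖w‖)]
  have e : w ^ 3 / q = w ^ 3 * (starRingEnd ℂ) q * ((Complex.normSq q)⁻¹ : ℝ) := by
    rw [div_eq_mul_inv, Complex.inv_def]
    push_cast
    ring
  have hc : w ^ 3 * (starRingEnd ℂ) q
      = w ^ 3 - ((t ^ 2 * (w.re ^ 2 + w.im ^ 2) ^ 2 : ℝ) : ℂ) * w := by
    apply Complex.ext <;> simp [hqdef, pow_succ] <;> ring
  have hp : 0 ≤ w.re ^ 2 + w.im ^ 2 := by positivity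
  have hX : t ^ 2 * (w.re ^ 2 + w.im ^ 2) ^ 2 ≤ 1 / 4 * (w.re ^ 2 + w.im ^ 2) := by
    rw [hr] at hr1
    nlinarith [mul_nonneg ht0 hp]
  have hX0 : 0 ≤ t ^ 2 * (w.re ^ 2 + w.im ^ 2) ^ 2 := by positivity
  rw [e, Complex.re_mul_ofReal, Complex.im_mul_ofReal, hc]
  constructor
  · have e1 : (w ^ 3 - ((t ^ 2 * (w.re ^ 2 + w.im ^ 2) ^ 2 : ℝ) : ℂ) * w).re
        = w.re * (w.re ^ 2 - 3 * w.im ^ 2 - t ^ 2 * (w.re ^ 2 + w.im ^ 2) ^ 2) := by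
      rw [Complex.sub_re, Complex.re_ofReal_mul]
      simp [pow_succ]
      ring
    rw [e1]
    refine bound _ ?_ _
    rw [hr, abs_le]
    constructor <;> nlinarith [sq_nonneg w.re, sq_nonneg w.im]
  · have e1 : (w ^ 3 - ((t ^ 2 * (w.re ^ 2 + w.im ^ 2) ^ 2 : ℝ) : ℂ) * w).im
        = w.im * (3 * w.re ^ 2 - w.im ^ 2 - t ^ 2 * (w.re ^ 2 + w.im ^ 2) ^ 2) := by
      rw [Complex.sub_im, Complex.im_ofReal_mul]
      simp [pow_succ]
      ring
    rw [e1]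
    refine bound _ ?_ _
    rw [hr, abs_le]
    constructor <;> nlinarith [sq_nonneg w.re, sq_nonneg w.im]

theorem abs_re_logRatio_sub_le {w : ℂ} (hw : ‖w‖ ≤ 1 / 2) :
    |(logRatio w).re - 2 * w.re| ≤ 12 * ‖w‖ ^ 2 * |w.re| := by
  have h := norm_image_sub_le_of_norm_deriv_le_segment_01'
    (f := fun t : ℝ => (logRatio (t * w) - 2 * (t * w)).re)
    (f' := fun t : ℝ => (2 * (t : ℂ) ^ 2 * (w ^ 3 / (1 - (t * w) ^ 2))).re)
    (C := 12 * ‖w‖ ^ 2 * |w.re|)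
    (fun t ht => by
      have d := Complex.reCLM.hasFDerivAt.comp_hasDerivAt t (hasDerivAt_logRatio_segment hw ht).2
      exact d.hasDerivWithinAt)
    (fun t ht => by
      have h1 := (cube_div_one_sub_sq_parts_le hw (Ico_subset_Icc_self ht)).1
      have h2 : t ^ 2 ≤ 1 := by nlinarith [ht.1, ht.2]
      rw [show (2 * (t : ℂ) ^ 2) = ((2 * t ^ 2 : ℝ) : ℂ) by push_cast; ring, Complex.re_ofReal_mul,
        Real.norm_eq_abs, abs_mul, abs_of_nonneg (by positivity)]
      nlinarith [abs_nonneg (w ^ 3 / (1 - (t * w) ^ 2)).re, sq_nonneg t])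
  simpa [logRatio] using h

theorem abs_im_logRatio_sub_le {w : ℂ} (hw : ‖w‖ ≤ 1 / 2) :
    |(logRatio w).im - 2 * w.im| ≤ 12 * ‖w‖ ^ 2 * |w.im| := by
  have h := norm_image_sub_le_of_norm_deriv_le_segment_01'
    (f := fun t : ℝ => (logRatio (t * w) - 2 * (t * w)).im)
    (f' := fun t : ℝ => (2 * (t : ℂ) ^ 2 * (w ^ 3 / (1 - (t * w) ^ 2))).im)
    (C := 12 * ‖w‖ ^ 2 * |w.im|)
    (fun t ht => by
      have d := Complex.imCLM.hasFDerivAt.comp_hasDerivAt t (hasDerivAt_logRatio_segment hw ht).2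
      exact d.hasDerivWithinAt)
    (fun t ht => by
      have h1 := (cube_div_one_sub_sq_parts_le hw (Ico_subset_Icc_self ht)).2
      have h2 : t ^ 2 ≤ 1 := by nlinarith [ht.1, ht.2]
      rw [show (2 * (t : ℂ) ^ 2) = ((2 * t ^ 2 : ℝ) : ℂ) by push_cast; ring, Complex.im_ofReal_mul,
        Real.norm_eq_abs, abs_mul, abs_of_nonneg (by positivity)]
      nlinarith [abs_nonneg (w ^ 3 / (1 - (t * w) ^ 2)).im, sq_nonneg t])
  simpa [logRatio] using h

/-! ### Zeros of the characteristic function in a strip -/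

/-- The integral `∫ |i y + τ|⁻¹ dμ(τ)`, which controls the Stieltjes transform near `i y`. -/
def stieltjesBound (μ : Measure ℝ) (y : ℝ) : ℝ := ∫ τ, ‖(Complex.I * y + (τ : ℂ))⁻¹‖ ∂μ

/-- The map whose fixed points near `i y` are zeros of the characteristic function if `y ∈ π ℤ`. -/
def rootMap (μ : Measure ℝ) (y : ℝ) (z : ℂ) : ℂ := Complex.I * y - logRatio (stieltjes μ z)

theorem norm_stieltjes_le_stieltjesBound (hpos : ∀ᵐ τ ∂μ, 0 < τ)
    (hinv : Integrable (fun τ : ℝ => τ⁻¹) μ) {y : ℝ} {z : ℂ} (hy : 100 ≤ |y|)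
    (hz : ‖z - Complex.I * y‖ ≤ 1) : ‖stieltjes μ z‖ ≤ 2 * stieltjesBound μ y :=
  norm_stieltjes_le hpos hinv (by rintro rfl; norm_num at hy) (by linarith)

/-- The actual Lipschitz constant is at most `3 · 4 / 1000`, well below `1/2`. -/
theorem norm_rootMap_sub_le (hpos : ∀ᵐ τ ∂μ, 0 < τ)
    (hinv : Integrable (fun τ : ℝ => τ⁻¹) μ) {y : ℝ} {z w : ℂ} (hy : 100 ≤ |y|)
    (hB : stieltjesBound μ y ≤ 1 / 1000)
    (hz : ‖z - Complex.I * y‖ ≤ 1) (hw : ‖w - Complex.I * y‖ ≤ 1) :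
    ‖rootMap μ y z - rootMap μ y w‖ ≤ 1 / 2 * ‖z - w‖ := by
  have hy0 : y ≠ 0 := by rintro rfl; norm_num at hy
  have h1 := norm_stieltjes_le_stieltjesBound hpos hinv hy hz
  have h2 := norm_stieltjes_le_stieltjesBound hpos hinv hy hw
  have h3 := norm_logRatio_sub_le (w := stieltjes μ z) (w' := stieltjes μ w)
    (by linarith) (by linarith)
  have h4 := norm_stieltjes_sub_le hpos hinv hy0 (z := z) (w := w) (by linarith) (by linarith)
  have h5 : ∫ τ, (τ ^ 2 + y ^ 2)⁻¹ ∂μ ≤ stieltjesBound μ y :=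
    integral_inv_sq_le hpos hinv (by linarith)
  rw [rootMap, rootMap, sub_sub_sub_cancel_left, norm_sub_rev]
  nlinarith [norm_nonneg (z - w)]

/-- Used twice: the unit disc is mapped into itself, and fixed points have `|Re z|` smaller than the
strip width once the bound is below `H/6`. -/
theorem norm_rootMap_sub_center_le (hpos : ∀ᵐ τ ∂μ, 0 < τ)
    (hinv : Integrable (fun τ : ℝ => τ⁻¹) μ) {y : ℝ} {z : ℂ} (hy : 100 ≤ |y|)
    (hB : stieltjesBound μ y ≤ 1 / 1000) (hz : ‖z - Complex.I * y‖ ≤ 1) :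
    ‖rootMap μ y z - Complex.I * y‖ ≤ 6 * stieltjesBound μ y := by
  have h1 := norm_stieltjes_le_stieltjesBound hpos hinv hy hz
  have h2 := norm_logRatio_le (w := stieltjes μ z) (by linarith)
  rw [rootMap, sub_sub_cancel_left, norm_neg]
  linarith

theorem exists_rootMap_eq (hpos : ∀ᵐ τ ∂μ, 0 < τ)
    (hinv : Integrable (fun τ : ℝ => τ⁻¹) μ) {y : ℝ} (hy : 100 ≤ |y|)
    (hB : stieltjesBound μ y ≤ 1 / 1000) :
    ∃ z : ℂ, ‖z - Complex.I * y‖ ≤ 1 ∧ rootMap μ y z = z := by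
  have hmaps : MapsTo (rootMap μ y) (Metric.closedBall (Complex.I * y) 1)
      (Metric.closedBall (Complex.I * y) 1) := fun z hz => by
    rw [mem_closedBall_iff_norm] at hz ⊢
    have := norm_rootMap_sub_center_le hpos hinv hy hB hz
    linarith
  have hc : ContractingWith (1 / 2) (hmaps.restrict _ _ _) := by
    refine ⟨by rw [one_div]; exact inv_lt_one_of_one_lt₀ one_lt_two,
      LipschitzWith.of_dist_le_mul fun z w => ?_⟩
    rw [Subtype.dist_eq, Subtype.dist_eq, dist_eq_norm, dist_eq_norm]
    simpa using norm_rootMap_sub_le hpos hinv hy hB (mem_closedBall_iff_norm.1 z.2)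
      (mem_closedBall_iff_norm.1 w.2)
  obtain ⟨z, hz, h, -⟩ := hc.exists_fixedPoint' Metric.isClosed_closedBall.isComplete hmaps
    (Metric.mem_closedBall_self zero_le_one) (edist_ne_top _ _)
  exact ⟨z, mem_closedBall_iff_norm.1 hz, h⟩

theorem rootMap_fixed_unique (hpos : ∀ᵐ τ ∂μ, 0 < τ)
    (hinv : Integrable (fun τ : ℝ => τ⁻¹) μ) {y : ℝ} {z w : ℂ} (hy : 100 ≤ |y|)
    (hB : stieltjesBound μ y ≤ 1 / 1000)
    (hz : ‖z - Complex.I * y‖ ≤ 1) (hw : ‖w - Complex.I * y‖ ≤ 1)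
    (hz' : rootMap μ y z = z) (hw' : rootMap μ y w = w) : z = w := by
  have h := norm_rootMap_sub_le hpos hinv hy hB hz hw
  rw [hz', hw'] at h
  rw [← sub_eq_zero, ← norm_le_zero_iff]
  linarith

/-- The measure is real and the logarithms stay off their cuts. With uniqueness of fixed points this
yields `z_{-n} = conj z_n`. -/
theorem rootMap_conj (hpos : ∀ᵐ τ ∂μ, 0 < τ)
    (hinv : Integrable (fun τ : ℝ => τ⁻¹) μ) {y : ℝ} {z : ℂ} (hy : 100 ≤ |y|)
    (hB : stieltjesBound μ y ≤ 1 / 1000) (hz : ‖z - Complex.I * y‖ ≤ 1) :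
    rootMap μ (-y) ((starRingEnd ℂ) z) = (starRingEnd ℂ) (rootMap μ y z) := by
  have h1 := norm_stieltjes_le_stieltjesBound hpos hinv hy hz
  rw [rootMap, rootMap, stieltjes_conj, logRatio_conj (by linarith)]
  simp

/-- In use `k = |κ|` for `κ = K(iy)`, while `a`, `b`, `l` are the same part (real or imaginary) of
`κ`, of `K(z)` and of `log((1+K(z))/(1-K(z)))`. -/
theorem relative_error_im {k a b l : ℝ} (hk : 0 ≤ k) (hk' : k ≤ 1)
    (h : |b - a| ≤ k * |a|) (hl : |l - 2 * b| ≤ 1 / 10 * k * |b|) :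
    |-l + 2 * a| ≤ 3 * k * |a| := by
  have h1 : |b| ≤ 2 * |a| := by
    have := abs_sub_abs_le_abs_sub b a
    nlinarith [abs_nonneg a]
  have h2 : |-l + 2 * a| ≤ |l - 2 * b| + 2 * |b - a| := by
    rw [show -l + 2 * a = -(l - 2 * b) - 2 * (b - a) by ring]
    refine (abs_sub _ _).trans ?_
    rw [abs_neg, abs_mul, abs_two]
  have h3 : 1 / 10 * k * |b| ≤ 1 / 10 * k * (2 * |a|) := by gcongr
  linarith [mul_nonneg hk (abs_nonneg a)]

/-- The bound on `b - a` contains `l` itself because `|Re z| = |l|`. The small factor `q` lets this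
term be absorbed first, giving `|l| ≤ 4a`; reinserting that makes it of relative size `k`. -/
theorem relative_error_re {k a b l q : ℝ} (hk : 0 ≤ k) (hk' : k ≤ 1 / 100) (ha : 0 ≤ a)
    (hq : 0 ≤ q) (hqk : 100 * q ≤ k) (h : |b - a| ≤ 4 * |l| * q + 2 / 5 * k * a)
    (hl : |l - 2 * b| ≤ 1 / 10 * k * |b|) :
    |-l + 2 * a| ≤ 3 * k * a := by
  have h1 : |b| ≤ a + |b - a| := by
    have := abs_sub_abs_le_abs_sub b a
    rw [abs_of_nonneg ha] at this
    linarith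
  have h2 : |l| ≤ 3 * |b| := by
    have := abs_sub_abs_le_abs_sub l (2 * b)
    rw [abs_mul, abs_two] at this
    nlinarith [abs_nonneg b]
  have h3 : 4 * |l| * q ≤ 4 * |l| * (1 / 10000) := by
    gcongr
    linarith
  have h4 : 2 / 5 * k * a ≤ 2 / 5 * (1 / 100) * a := by gcongr
  have h5 : |l| ≤ 4 * a := by linarith [abs_nonneg l]
  have h6 : 4 * |l| * q ≤ 4 * (4 * a) * (k / 100) := by
    gcongr
    linarith
  have hka := mul_nonneg hk ha
  have h7 : |b - a| ≤ k * |a| := by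
    rw [abs_of_nonneg ha]
    linarith
  have h8 := relative_error_im hk (by linarith) h7 hl
  rwa [abs_of_nonneg ha] at h8

/-- Asymptotics of the fixed points of `rootMap`, with errors relative to the real and to the
imaginary part of the Stieltjes transform at `i y`. -/
theorem rootMap_fixed_asymptotics (hpos : ∀ᵐ τ ∂μ, 0 < τ)
    (hinv : Integrable (fun τ : ℝ => τ⁻¹) μ) {y : ℝ} {z : ℂ} (hy : 100 ≤ |y|)
    (hB : stieltjesBound μ y ≤ 1 / 1000) (hz : ‖z - Complex.I * y‖ ≤ 1)
    (hz' : rootMap μ y z = z) :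
    |z.im - y + 2 * (stieltjes μ (Complex.I * y)).im|
        ≤ 3 * ‖stieltjes μ (Complex.I * y)‖ * |(stieltjes μ (Complex.I * y)).im| ∧
    |z.re + 2 * (stieltjes μ (Complex.I * y)).re|
        ≤ 3 * ‖stieltjes μ (Complex.I * y)‖ * (stieltjes μ (Complex.I * y)).re ∧
    3 * ‖stieltjes μ (Complex.I * y)‖ ≤ 1 := by
  have hy0 : y ≠ 0 := by rintro rfl; norm_num at hy
  have h1 := norm_stieltjes_le_stieltjesBound hpos hinv hy hz
  have h2 := norm_stieltjes_le_stieltjesBound hpos hinv hy (z := Complex.I * y) (by simp)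
  have h3 := norm_stieltjes_sub_le hpos hinv hy0 (z := z) (w := Complex.I * y)
    (by linarith) (by rw [sub_self, norm_zero]; positivity)
  have h4 := abs_re_stieltjes_sub_le hpos hinv hy0 (z := z) (by linarith)
  have hQ0 : 0 ≤ ∫ τ, (τ ^ 2 + y ^ 2)⁻¹ ∂μ := integral_nonneg fun τ => by positivity
  have hQB : ∫ τ, (τ ^ 2 + y ^ 2)⁻¹ ∂μ ≤ stieltjesBound μ y :=
    integral_inv_sq_le hpos hinv (by linarith)
  have hI : |(stieltjes μ (Complex.I * y)).im| = |y| * ∫ τ, (τ ^ 2 + y ^ 2)⁻¹ ∂μ := by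
    rw [stieltjes_I_mul_im hpos hinv hy0, abs_neg, abs_mul, abs_of_nonneg hQ0]
  have hr0 : 0 ≤ (stieltjes μ (Complex.I * y)).re := by
    rw [stieltjes_I_mul_re hpos hinv hy0]
    refine integral_nonneg_of_ae ?_
    filter_upwards [hpos] with τ hτ
    positivity
  have hi := Complex.abs_im_le_norm (stieltjes μ (Complex.I * y))
  have hL := norm_logRatio_le (w := stieltjes μ z) (by linarith)
  have hLr := abs_re_logRatio_sub_le (w := stieltjes μ z) (by linarith)
  have hLi := abs_im_logRatio_sub_le (w := stieltjes μ z) (by linarith)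
  have hd : z - Complex.I * y = -logRatio (stieltjes μ z) := by
    rw [rootMap] at hz'
    linear_combination -hz'
  have hdx : z.re = -(logRatio (stieltjes μ z)).re := by
    have := congrArg Complex.re hd
    simpa using this
  have hdy : z.im - y = -(logRatio (stieltjes μ z)).im := by
    have := congrArg Complex.im hd
    simpa using this
  have hdn : ‖z - Complex.I * y‖ = ‖logRatio (stieltjes μ z)‖ := by rw [hd, norm_neg]
  have h3i : |(stieltjes μ z).im - (stieltjes μ (Complex.I * y)).im|
      ≤ ‖stieltjes μ z - stieltjes μ (Complex.I * y)‖ := by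
    simpa using Complex.abs_im_le_norm (stieltjes μ z - stieltjes μ (Complex.I * y))
  have hn := norm_le_norm_add_norm_sub' (stieltjes μ z) (stieltjes μ (Complex.I * y))
  -- Since `Im K(iy) = -yQ` with `Q` the integral, a Lipschitz error proportional to `Q` is small
  -- relative to the imaginary part.
  have hyQ : 100 * ∫ τ, (τ ^ 2 + y ^ 2)⁻¹ ∂μ ≤ |(stieltjes μ (Complex.I * y)).im| := by
    rw [hI]
    exact mul_le_mul_of_nonneg_right hy hQ0
  rw [hdn] at h3 h4 hz
  generalize stieltjes μ (Complex.I * y) = κ at *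
  generalize logRatio (stieltjes μ z) = L at *
  generalize stieltjes μ z = K at *
  generalize (∫ τ, (τ ^ 2 + y ^ 2)⁻¹ ∂μ) = Q at *
  -- From `|L| ≤ 3|K| ≤ 3(|κ| + 4|L|Q)`, absorbing the `L` term on the right.
  have hdκ : ‖L‖ ≤ 4 * ‖κ‖ := by
    have h5 : 4 * ‖L‖ * Q ≤ 4 * ‖L‖ * (1 / 1000) := by
      gcongr
      linarith
    linarith [norm_nonneg κ]
  have hKκ : ‖K‖ ≤ 2 * ‖κ‖ := by
    have h5 : 4 * ‖L‖ * Q ≤ 4 * 1 * Q := by gcongr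
    linarith
  have hκs : ‖κ‖ ≤ 1 / 500 := by linarith
  have hKsq : 12 * ‖K‖ ^ 2 ≤ 1 / 10 * ‖κ‖ := by
    calc 12 * ‖K‖ ^ 2 ≤ 12 * (2 * ‖κ‖) ^ 2 := by gcongr
      _ = 48 * ‖κ‖ * ‖κ‖ := by ring
      _ ≤ 48 * (1 / 500) * ‖κ‖ := by gcongr
      _ ≤ 1 / 10 * ‖κ‖ := by linarith [norm_nonneg κ]
  refine ⟨?_, ?_, by linarith⟩
  · rw [hdy]
    refine relative_error_im (norm_nonneg κ) (by linarith) (h3i.trans (h3.trans ?_))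
      (hLi.trans (by gcongr))
    calc 4 * ‖L‖ * Q ≤ 4 * (4 * ‖κ‖) * (|κ.im| / 100) := by
          gcongr
          linarith
      _ ≤ ‖κ‖ * |κ.im| := by linarith [mul_nonneg (norm_nonneg κ) (abs_nonneg κ.im)]
  · rw [hdx] at h4 ⊢
    rw [abs_neg] at h4
    refine relative_error_re (norm_nonneg κ) (by linarith) hr0 hQ0 (by linarith) (h4.trans ?_)
      (hLr.trans (by gcongr))
    -- The factor `2/5` is `10 · 4 / 100`, from `|L| ≤ 4|κ|` and `|y| ≥ 100`.
    gcongr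
    rw [div_le_iff₀ (by linarith)]
    have h5 := mul_le_mul_of_nonneg_left hy (norm_nonneg κ)
    linarith

/-- The characteristic function, whose zeros off the real axis are the eigenvalues of `-𝒜`. -/
def characteristicFn (μ : Measure ℝ) (z : ℂ) : ℂ :=
  Complex.exp (2 * z) * (1 + stieltjes μ z) ^ 2 - (1 - stieltjes μ z) ^ 2

/-- Dividing by `(1-K)² ≠ 0` leaves `exp(2(z + log((1+K)/(1-K)))) = 1`. Even and odd `n` correspond
to the two signs in `e^z(1+K) = ±(1-K)`. -/
theorem characteristicFn_eq_zero_iff {z : ℂ} (h : ‖stieltjes μ z‖ ≤ 1 / 2) :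
    characteristicFn μ z = 0 ↔ ∃ n : ℤ, rootMap μ (Real.pi * n) z = z := by
  have h1 := Complex.slitPlane_ne_zero (one_sub_mem_slitPlane h)
  have e : characteristicFn μ z = (1 - stieltjes μ z) ^ 2
      * (Complex.exp (2 * (z + logRatio (stieltjes μ z))) - 1) := by
    rw [characteristicFn, mul_add, Complex.exp_add, two_mul (logRatio _), Complex.exp_add, exp_logRatio h]
    field_simp
  rw [e, mul_eq_zero, or_iff_right (pow_ne_zero 2 h1), sub_eq_zero, Complex.exp_eq_one_iff]
  refine exists_congr fun n => ?_
  rw [rootMap]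
  push_cast
  constructor <;> intro h
  · linear_combination -(1 / 2) * h
  · linear_combination -2 * h

theorem norm_stieltjes_le_of_strip (hpos : ∀ᵐ τ ∂μ, 0 < τ)
    (hinv : Integrable (fun τ : ℝ => τ⁻¹) μ) {z : ℂ} (hy : z.im ≠ 0) (h : |z.re| ≤ |z.im| / 2) :
    ‖stieltjes μ z‖ ≤ 2 * stieltjesBound μ z.im := by
  refine norm_stieltjes_le hpos hinv hy ?_
  have e : z - Complex.I * z.im = (z.re : ℂ) := by
    apply Complex.ext <;> simp
  rwa [e, Complex.norm_real]

/-- The zeros of the characteristic function in a strip to the left of the imaginary axis. -/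
theorem exists_characteristicFn_zeros (hpos : ∀ᵐ τ ∂μ, 0 < τ) (hinv : Integrable (fun τ : ℝ => τ⁻¹) μ)
    (hμ : μ ≠ 0) {H : ℝ} (hH : 0 < H) :
    ∃ N : ℕ, 0 < N ∧ ∃ z : ℤ → ℂ,
      (∀ n : ℤ, (N : ℤ) ≤ |n| → characteristicFn μ (z n) = 0 ∧ |(z n).im - Real.pi * n| ≤ 1 ∧
        0 < -(z n).re ∧ -(z n).re < H ∧ z (-n) = (starRingEnd ℂ) (z n) ∧
        ∃ ε δ : ℝ, |ε| ≤ 3 * ‖stieltjes μ (Complex.I * (Real.pi * n))‖ ∧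
          |δ| ≤ 3 * ‖stieltjes μ (Complex.I * (Real.pi * n))‖ ∧
          (z n).im = Real.pi * n - (2 + ε) * (stieltjes μ (Complex.I * (Real.pi * n))).im ∧
          (z n).re = -((2 + δ) * (stieltjes μ (Complex.I * (Real.pi * n))).re)) ∧
      ∀ w ∈ stripRegion H (Real.pi * N + 1), characteristicFn μ w = 0 →
        ∃ n : ℤ, (N : ℤ) ≤ |n| ∧ w = z n := by
  obtain ⟨Y, hY⟩ := exists_forall_integral_norm_inv_lt hpos hinv
    (lt_min (by norm_num : (0 : ℝ) < 1 / 1000) (by positivity : 0 < H / 6))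
  have hpi := Real.pi_gt_three
  -- The bound `2H` ensures `|Re w| ≤ |Im w| / 2` for strip points with `|Im w| ≥ N`, as the
  -- comparison with the imaginary axis requires.
  obtain ⟨N, hN⟩ := exists_nat_ge (max Y (max 100 (2 * H)))
  obtain ⟨hN1, hN2⟩ := max_le_iff.1 hN
  obtain ⟨hN2, hN3⟩ := max_le_iff.1 hN2
  have hbig : ∀ y : ℝ, N ≤ |y| → 100 ≤ |y| ∧ stieltjesBound μ y ≤ 1 / 1000 ∧
      6 * stieltjesBound μ y < H := by
    intro y hy
    have h := lt_min_iff.1 (hY y (hN1.trans hy))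
    have h2 : stieltjesBound μ y < H / 6 := h.2
    exact ⟨hN2.trans hy, h.1.le, by linarith⟩
  have habs : ∀ n : ℤ, (N : ℤ) ≤ |n| → (N : ℝ) ≤ |Real.pi * n| := by
    intro n hn
    have : (N : ℝ) ≤ |(n : ℝ)| := by exact_mod_cast hn
    rw [abs_mul, abs_of_pos Real.pi_pos]
    nlinarith
  have hex : ∀ n : ℤ, ∃ z : ℂ, (N : ℤ) ≤ |n| →
      ‖z - Complex.I * (Real.pi * n : ℝ)‖ ≤ 1 ∧ rootMap μ (Real.pi * n) z = z := by
    intro n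
    by_cases hn : (N : ℤ) ≤ |n|
    · obtain ⟨h1, h2, -⟩ := hbig _ (habs n hn)
      obtain ⟨z, hz⟩ := exists_rootMap_eq hpos hinv h1 h2
      exact ⟨z, fun _ => hz⟩
    · exact ⟨0, fun h => absurd h hn⟩
  choose z hz using hex
  have hN0 : 0 < N := by
    have : (0 : ℝ) < N := by linarith
    exact_mod_cast this
  refine ⟨N, hN0, z, fun n hn => ?_, fun w hw hw0 => ?_⟩
  · obtain ⟨hy, hB, hBH⟩ := hbig _ (habs n hn)
    obtain ⟨h1, h2⟩ := hz n hn
    have hy0 : Real.pi * n ≠ 0 := by intro h; rw [h] at hy; norm_num at hy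
    have hK := norm_stieltjes_le_stieltjesBound hpos hinv hy h1
    have hd := norm_rootMap_sub_center_le hpos hinv hy hB h1
    rw [h2] at hd
    obtain ⟨ai, ar, as⟩ := rootMap_fixed_asymptotics hpos hinv hy hB h1 h2
    have hr := stieltjes_I_mul_re_pos hpos hinv hμ hy0
    have hi : (stieltjes μ (Complex.I * (Real.pi * n : ℝ))).im ≠ 0 := by
      rw [stieltjes_I_mul_im hpos hinv hy0]
      exact neg_ne_zero.2 (mul_ne_zero hy0 (integral_inv_sq_pos hpos hinv hμ hy0).ne')
    have hre : |(z n).re| ≤ ‖z n - Complex.I * (Real.pi * n : ℝ)‖ := by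
      simpa using Complex.abs_re_le_norm (z n - Complex.I * (Real.pi * n : ℝ))
    have him : |(z n).im - Real.pi * n| ≤ ‖z n - Complex.I * (Real.pi * n : ℝ)‖ := by
      simpa using Complex.abs_im_le_norm (z n - Complex.I * (Real.pi * n : ℝ))
    refine ⟨(characteristicFn_eq_zero_iff (by linarith)).2 ⟨n, h2⟩, him.trans h1, ?_, ?_, ?_, ?_⟩
    · have := (abs_le.1 ar).2
      nlinarith
    · have := (abs_le.1 hre).1
      linarith
    · obtain ⟨h3, h4⟩ := hz (-n) (by rwa [abs_neg])
      have e : Real.pi * ((-n : ℤ) : ℝ) = -(Real.pi * n) := by push_cast; ring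
      rw [e] at h3 h4
      refine rootMap_fixed_unique hpos hinv (by rwa [abs_neg])
        (hbig _ (by rw [abs_neg]; exact habs n hn)).2.1 h3 ?_ h4 ?_
      · rw [show (starRingEnd ℂ) (z n) - Complex.I * ((-(Real.pi * n) : ℝ) : ℂ)
          = (starRingEnd ℂ) (z n - Complex.I * (Real.pi * n : ℝ)) by simp, RCLike.norm_conj]
        exact h1
      · rw [rootMap_conj hpos hinv hy hB h1, h2]
    · rw [← Complex.ofReal_intCast, ← Complex.ofReal_mul]
      set κ := stieltjes μ (Complex.I * (Real.pi * n : ℝ))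
      -- The two relations are solved for `ε` and `δ`; the divisions are legitimate because both
      -- parts of `κ` are nonzero for a nonzero measure.
      refine ⟨-((z n).im - Real.pi * n + 2 * κ.im) / κ.im, -((z n).re + 2 * κ.re) / κ.re,
        ?_, ?_, ?_, ?_⟩
      · rw [abs_div, abs_neg]
        exact div_le_of_le_mul₀ (abs_nonneg _) (by positivity) ai
      · rw [abs_div, abs_neg]
        refine div_le_of_le_mul₀ (abs_nonneg _) (by positivity) ?_
        rwa [abs_of_pos hr]
      · field_simp
        ring
      · field_simp
        ring
  · obtain ⟨hw1, hw2, hw3⟩ := hw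
    have hwN : (N : ℝ) ≤ |w.im| := by nlinarith
    obtain ⟨hy, hB, -⟩ := hbig _ hwN
    have hwre : |w.re| ≤ |w.im| / 2 := by
      rw [abs_of_neg (by linarith)]
      linarith
    have hK := norm_stieltjes_le_of_strip hpos hinv
      (by intro h; rw [h] at hy; norm_num at hy) hwre
    obtain ⟨n, hn⟩ := (characteristicFn_eq_zero_iff (by linarith)).1 hw0
    have hL := norm_logRatio_le (w := stieltjes μ w) (by linarith)
    have hwn : ‖w - Complex.I * (Real.pi * n : ℝ)‖ ≤ 1 := by
      have e : w - Complex.I * (Real.pi * n : ℝ) = -logRatio (stieltjes μ w) := by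
        rw [rootMap] at hn
        linear_combination -hn
      rw [e, norm_neg]
      linarith
    have him : |w.im - Real.pi * n| ≤ ‖w - Complex.I * (Real.pi * n : ℝ)‖ := by
      simpa using Complex.abs_im_le_norm (w - Complex.I * (Real.pi * n : ℝ))
    -- The `+ 1` in the region `|Im w| > πN + 1` pays for the distance from `w` to `iπn`.
    have hn2 : (N : ℤ) ≤ |n| := by
      have h1 := abs_sub_abs_le_abs_sub w.im (Real.pi * n)
      rw [abs_mul, abs_of_pos Real.pi_pos] at h1
      have h2 : Real.pi * (N : ℝ) ≤ Real.pi * |(n : ℝ)| := by linarith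
      have h3 := le_of_mul_le_mul_left h2 Real.pi_pos
      exact_mod_cast h3
    obtain ⟨h1, h2⟩ := hz n hn2
    obtain ⟨hy', hB', -⟩ := hbig _ (habs n hn2)
    exact ⟨n, hn2, rootMap_fixed_unique hpos hinv hy' hB' hwn h1 hn h2⟩

/-! ### Calculus of weak derivatives on the unit interval -/

instance isProbabilityMeasure_restrict_Ioo :
    IsProbabilityMeasure (volume.restrict (Ioo (0 : ℝ) 1)) :=
  ⟨by simp⟩

/-- Multiplication by a bounded measurable function on `L²`. -/
def mulL {E : Type*} [NormedAddCommGroup E] [NormedSpace ℂ E] {μ : Measure ℝ} {m : ℝ → ℂ}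
    (hm : MemLp m ∞ μ) : Lp E 2 μ →L[ℂ] Lp E 2 μ :=
  (ContinuousLinearMap.lsmul ℂ ℂ).holderL μ ∞ 2 2 hm.toLp

theorem mulL_coeFn {E : Type*} [NormedAddCommGroup E] [NormedSpace ℂ E] {μ : Measure ℝ} {m : ℝ → ℂ}
    (hm : MemLp m ∞ μ) (u : Lp E 2 μ) : mulL hm u =ᵐ[μ] fun x => m x • u x := by
  have h := (ContinuousLinearMap.lsmul ℂ ℂ : ℂ →L[ℂ] E →L[ℂ] E).coeFn_holder (r := 2) hm.toLp u
  refine h.trans ?_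
  filter_upwards [hm.coeFn_toLp] with x hx
  simp [hx]

/-- A function that is continuous on `ℝ` belongs to `L^p(0,1)`. -/
theorem memLp_of_continuous {F : ℝ → ℂ} (hF : Continuous F) (p : ℝ≥0∞) :
    MemLp F p (volume.restrict (Ioo (0 : ℝ) 1)) := by
  obtain ⟨C, hC⟩ := isCompact_Icc.exists_bound_of_continuousOn (hF.continuousOn (s := Icc (0 : ℝ) 1))
  exact MemLp.of_bound hF.aestronglyMeasurable C ((ae_restrict_iff' measurableSet_Ioo).2
    (Eventually.of_forall fun x hx => hC x (Ioo_subset_Icc_self hx)))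

theorem continuous_cexp_mul (c : ℂ) : Continuous fun x : ℝ => Complex.exp (c * x) := by fun_prop

/-- Multiplication by `e^{cx}` on `L²(0,1)`. -/
def mulExp (c : ℂ) : L2Interval →L[ℂ] L2Interval :=
  mulL (memLp_of_continuous (continuous_cexp_mul c) ∞)

theorem mulExp_coeFn (c : ℂ) (u : L2Interval) :
    mulExp c u =ᵐ[volume.restrict (Ioo (0 : ℝ) 1)] fun x => Complex.exp (c * x) * u x :=
  mulL_coeFn _ u

theorem mulExp_neg_mulExp (c : ℂ) (u : L2Interval) : mulExp (-c) (mulExp c u) = u := by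
  refine Lp.ext ?_
  filter_upwards [mulExp_coeFn (-c) (mulExp c u), mulExp_coeFn c u] with x h1 h2
  rw [h1, h2, ← mul_assoc, ← Complex.exp_add]
  simp

/-- The constant function `1` in `L²(0,1)`. -/
def oneL : L2Interval := (memLp_of_continuous (continuous_const (y := (1 : ℂ))) 2).toLp

theorem oneL_coeFn : oneL =ᵐ[volume.restrict (Ioo (0 : ℝ) 1)] fun _ => (1 : ℂ) :=
  MemLp.coeFn_toLp _

/-- The function `e^{cx}` in `L²(0,1)`. -/
def expL (c : ℂ) : L2Interval := mulExp c oneL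

theorem setIntegral_eq_integral_of_tsupport_subset {E : Type*} [NormedAddCommGroup E]
    [NormedSpace ℝ E] {φ : ℝ → ℝ} (h : tsupport φ ⊆ Ioo 0 1) (u : ℝ → E) :
    ∫ x in Ioo (0 : ℝ) 1, φ x • u x = ∫ x, φ x • u x :=
  setIntegral_eq_integral_of_forall_compl_eq_zero fun x hx => by
    rw [image_eq_zero_of_notMem_tsupport (fun hx' => hx (h hx')), zero_smul]

theorem hasWeakDeriv_oneL : HasWeakDeriv oneL 0 := by
  intro φ h1 h2 h3
  have e1 : ∫ x in Ioo (0 : ℝ) 1, deriv φ x • oneL x = ∫ x in Ioo (0 : ℝ) 1, deriv φ x • (1 : ℂ) :=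
    integral_congr_ae (by filter_upwards [oneL_coeFn] with x hx; rw [hx])
  have e2 : ∫ x in Ioo (0 : ℝ) 1, φ x • (0 : L2Interval) x = 0 :=
    integral_eq_zero_of_ae (by filter_upwards [Lp.coeFn_zero ℂ 2 _] with x hx; rw [hx]; simp)
  have hφ0 : φ 0 = 0 := image_eq_zero_of_notMem_tsupport fun h => by simpa using h3 h
  have hφ1 : φ 1 = 0 := image_eq_zero_of_notMem_tsupport fun h => by simpa using h3 h
  have hd : Continuous (deriv φ) := h1.continuous_deriv (by simp)
  rw [e1, e2, integral_smul_const, ← integral_Ioc_eq_integral_Ioo,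
    ← intervalIntegral.integral_of_le zero_le_one, intervalIntegral.integral_deriv_eq_sub
      (fun x _ => (h1.differentiable (by simp)).differentiableAt) (hd.intervalIntegrable _ _),
    hφ0, hφ1]
  simp

/-- A function with vanishing weak derivative is constant. -/
theorem HasWeakDeriv.eq_smul_oneL {u : L2Interval} (h : HasWeakDeriv u 0) :
    ∃ c : ℂ, u = c • oneL := by
  let f : ContDiffBump (1 / 2 : ℝ) := ⟨1 / 8, 1 / 4, by norm_num, by norm_num⟩
  set ρ : ℝ → ℝ := f.normed volume with hρ
  have ρ1 : ContDiff ℝ ∞ ρ := f.contDiff_normed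
  have ρ2 : HasCompactSupport ρ := f.hasCompactSupport_normed
  have ρt : tsupport ρ = Metric.closedBall (1 / 2) (1 / 4) := f.tsupport_normed_eq
  have ρ3 : tsupport ρ ⊆ Ioo 0 1 := by
    rw [ρt, Real.closedBall_eq_Icc]
    intro x hx
    constructor <;> linarith [hx.1, hx.2]
  have ρi : ∫ x, ρ x = 1 := f.integral_normed
  set c : ℂ := ∫ x in Ioo (0 : ℝ) 1, ρ x • u x with hc
  refine ⟨c, sub_eq_zero.1 ?_⟩
  have hzero : ∀ φ : ℝ → ℝ, ∫ x in Ioo (0 : ℝ) 1, φ x • (0 : L2Interval) x = 0 := fun φ =>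
    integral_eq_zero_of_ae (by filter_upwards [Lp.coeFn_zero ℂ 2 _] with x hx; rw [hx]; simp)
  have key : ∀ φ : ℝ → ℝ, ContDiff ℝ ∞ φ → HasCompactSupport φ → tsupport φ ⊆ Ioo 0 1 →
      ∫ x in Ioo (0 : ℝ) 1, φ x • u x = (∫ x, φ x) * c := by
    intro φ h1 h2 h3
    set m : ℝ := ∫ x, φ x
    -- Removing the mean with a bump of integral one makes `η` the derivative of a test function,
    -- against which `u` integrates to zero.
    set η : ℝ → ℝ := fun x => φ x - m * ρ x with hη
    have hη1 : ContDiff ℝ ∞ η := h1.sub (contDiff_const.mul ρ1)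
    have hηc : Continuous η := hη1.continuous
    have hη0 : ∫ x, η x = 0 := by
      rw [hη, integral_sub (h1.continuous.integrable_of_hasCompactSupport h2)
        ((ρ1.continuous.integrable_of_hasCompactSupport ρ2).const_mul _), integral_const_mul, ρi]
      ring
    set K := tsupport φ ∪ tsupport ρ with hK
    have hKc : IsCompact K := h2.isCompact.union ρ2.isCompact
    have hKn : K.Nonempty := ⟨1 / 2, Or.inr (by rw [ρt]; simp)⟩
    have hK1 : K ⊆ Ioo 0 1 := union_subset h3 ρ3
    obtain ⟨a, haK, ha⟩ := hKc.exists_isLeast hKn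
    obtain ⟨b, hbK, hb⟩ := hKc.exists_isGreatest hKn
    have hηK : ∀ x, x ∉ K → η x = 0 := by
      intro x hx
      rw [hK, mem_union, not_or] at hx
      rw [hη]
      simp only
      rw [image_eq_zero_of_notMem_tsupport hx.1, image_eq_zero_of_notMem_tsupport hx.2]
      ring
    set Φ : ℝ → ℝ := fun x => ∫ t in (0 : ℝ)..x, η t with hΦ
    have hΦd : ∀ x, HasDerivAt Φ (η x) x := fun x =>
      intervalIntegral.integral_hasDerivAt_right (hηc.intervalIntegrable 0 x)
        (hηc.stronglyMeasurableAtFilter _ _) hηc.continuousAt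
    have hΦ' : deriv Φ = η := funext fun x => (hΦd x).deriv
    have hΦs : ContDiff ℝ ∞ Φ :=
      contDiff_infty_iff_deriv.2 ⟨fun x => (hΦd x).differentiableAt, hΦ' ▸ hη1⟩
    -- Left of `a` the integrand vanishes; right of `b` the primitive is the full integral of `η`,
    -- which is zero.
    have hsupp : Function.support Φ ⊆ Icc a b := by
      intro x hx
      by_contra hxn
      refine hx ?_
      rw [hΦ]
      simp only
      rcases lt_or_ge x a with hxa | hxa
      · rw [intervalIntegral.integral_congr (g := fun _ => (0 : ℝ)) fun t ht => hηK t fun htK => ?_]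
        · simp
        · have h5 := ha htK
          have h6 := (hK1 haK).1
          rcases le_total 0 x with h0 | h0
          · rw [uIcc_of_le h0] at ht
            linarith [ht.2]
          · rw [uIcc_of_ge h0] at ht
            linarith [ht.2]
      · have hxb : b < x := by
          by_contra hxb
          exact hxn ⟨hxa, not_lt.1 hxb⟩
        have h0 := (hK1 hbK).1
        rw [intervalIntegral.integral_of_le (by linarith),
          setIntegral_eq_integral_of_forall_compl_eq_zero, hη0]
        intro t ht
        refine hηK t fun htK => ht ⟨(hK1 htK).1, (hb htK).trans hxb.le⟩
    have hts : tsupport Φ ⊆ Icc a b := closure_minimal hsupp isClosed_Icc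
    have hΦc : HasCompactSupport Φ := HasCompactSupport.of_support_subset_isCompact isCompact_Icc hsupp
    have h6 := h Φ hΦs hΦc (hts.trans (Icc_subset_Ioo (hK1 haK).1 (hK1 hbK).2))
    rw [hzero, neg_zero, hΦ'] at h6
    have e : ∀ x, η x • u x = φ x • u x - m • (ρ x • u x) := fun x => by
      rw [hη, smul_smul, ← sub_smul]
    simp only [e] at h6
    have hρu : Integrable (fun x => m • (ρ x • u x)) (volume.restrict (Ioo (0 : ℝ) 1)) :=
      (integrable_smul_of_hasCompactSupport ρ1.continuous ρ2 u).smul m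
    rw [integral_sub (integrable_smul_of_hasCompactSupport h1.continuous h2 u) hρu, integral_smul, ← hc,
      sub_eq_zero] at h6
    rw [h6, Complex.real_smul]
  have hae : ∀ᵐ x ∂(volume : Measure ℝ), x ∈ Ioo (0 : ℝ) 1 → (u - c • oneL : L2Interval) x = 0 := by
    refine isOpen_Ioo.ae_eq_zero_of_integral_contDiff_smul_eq_zero
      (IntegrableOn.locallyIntegrableOn (L2Interval.integrable _)) fun φ h1 h2 h3 => ?_
    rw [← setIntegral_eq_integral_of_tsupport_subset h3]
    have e : ∫ x in Ioo (0 : ℝ) 1, φ x • (u - c • oneL : L2Interval) x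
        = ∫ x in Ioo (0 : ℝ) 1, (φ x • u x - φ x • c) := by
      refine integral_congr_ae ?_
      filter_upwards [Lp.coeFn_sub u (c • oneL), Lp.coeFn_smul c oneL, oneL_coeFn] with x e1 e2 e3
      rw [e1, Pi.sub_apply, e2, Pi.smul_apply, e3, smul_sub, smul_eq_mul, mul_one]
    rw [e, integral_sub (integrable_smul_of_hasCompactSupport h1.continuous h2 u)
      ((h1.continuous.integrable_of_hasCompactSupport h2).smul_const c).restrict,
      key φ h1 h2 h3, setIntegral_eq_integral_of_tsupport_subset h3, integral_smul_const]
    simp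
  rw [Lp.eq_zero_iff_ae_eq_zero]
  exact (ae_restrict_iff' measurableSet_Ioo).2 hae

/-- Weak derivatives can be tested with complex-valued functions. -/
theorem HasWeakDeriv.integral_deriv_mul {u g : L2Interval} (h : HasWeakDeriv u g) {χ : ℝ → ℂ}
    (h1 : ContDiff ℝ ∞ χ) (h2 : HasCompactSupport χ) (h3 : tsupport χ ⊆ Ioo 0 1) :
    ∫ x in Ioo (0 : ℝ) 1, deriv χ x * u x = -∫ x in Ioo (0 : ℝ) 1, χ x * g x := by
  have hr1 : ContDiff ℝ ∞ fun x => (χ x).re := Complex.reCLM.contDiff.comp h1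
  have hi1 : ContDiff ℝ ∞ fun x => (χ x).im := Complex.imCLM.contDiff.comp h1
  have hr2 : HasCompactSupport fun x => (χ x).re := h2.comp_left (g := Complex.re) rfl
  have hi2 : HasCompactSupport fun x => (χ x).im := h2.comp_left (g := Complex.im) rfl
  have hr3 : tsupport (fun x => (χ x).re) ⊆ Ioo 0 1 :=
    (closure_mono (Function.support_comp_subset (g := Complex.re) rfl χ)).trans h3
  have hi3 : tsupport (fun x => (χ x).im) ⊆ Ioo 0 1 :=
    (closure_mono (Function.support_comp_subset (g := Complex.im) rfl χ)).trans h3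
  have hd : ∀ x, HasDerivAt χ (deriv χ x) x := fun x =>
    ((h1.differentiable (by simp)) x).hasDerivAt
  have hrd : deriv (fun x => (χ x).re) = fun x => (deriv χ x).re := funext fun x =>
    (Complex.reCLM.hasFDerivAt.comp_hasDerivAt x (hd x)).deriv
  have hid : deriv (fun x => (χ x).im) = fun x => (deriv χ x).im := funext fun x =>
    (Complex.imCLM.hasFDerivAt.comp_hasDerivAt x (hd x)).deriv
  have hr := h _ hr1 hr2 hr3
  have hi := h _ hi1 hi2 hi3
  have ir := integrable_smul_of_hasCompactSupport (hr1.continuous_deriv (by simp)) hr2.deriv u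
  have ii := integrable_smul_of_hasCompactSupport (hi1.continuous_deriv (by simp)) hi2.deriv u
  have jr := integrable_smul_of_hasCompactSupport hr1.continuous hr2 g
  have ji := integrable_smul_of_hasCompactSupport hi1.continuous hi2 g
  rw [hrd] at hr ir
  rw [hid] at hi ii
  have e : ∀ a b : ℂ, a * b = a.re • b + Complex.I * (a.im • b) := fun a b => by
    conv_lhs => rw [← Complex.re_add_im a]
    rw [Complex.real_smul, Complex.real_smul]
    ring
  simp only [e (deriv χ _), e (χ _)]
  rw [integral_add ir (ii.const_mul _), integral_add jr (ji.const_mul _), integral_const_mul,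
    integral_const_mul, hr, hi]
  ring

/-- Product rule for weak derivatives and the smooth function `e^{cx}`. -/
theorem HasWeakDeriv.mulExp {u g : L2Interval} (h : HasWeakDeriv u g) (c : ℂ) :
    HasWeakDeriv (mulExp c u) (mulExp c (g + c • u)) := by
  intro φ h1 h2 h3
  set χ : ℝ → ℂ := fun x => (φ x : ℂ) * Complex.exp (c * x) with hχ
  have hφ1 : ContDiff ℝ ∞ fun x => (φ x : ℂ) := Complex.ofRealCLM.contDiff.comp h1
  have hE : ContDiff ℝ ∞ fun x : ℝ => Complex.exp (c * x) :=
    (contDiff_const.mul Complex.ofRealCLM.contDiff).cexp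
  have χ1 : ContDiff ℝ ∞ χ := hφ1.mul hE
  have hφ2 : HasCompactSupport fun x => (φ x : ℂ) := h2.comp_left (g := Complex.ofReal) rfl
  have χ2 : HasCompactSupport χ := hφ2.mul_right
  have hs : Function.support χ ⊆ Function.support φ := fun x hx h0 => hx (by
    rw [hχ]
    simp only
    rw [h0]
    simp)
  have χ3 : tsupport χ ⊆ Ioo 0 1 := (closure_mono hs).trans h3
  -- The exponential is moved onto the test function: `φ' e^{cx} = χ' - cχ`.
  have hd : ∀ x, deriv χ x
      = ((deriv φ x : ℝ) : ℂ) * Complex.exp (c * x) + c * χ x := by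
    intro x
    have d1 : HasDerivAt (fun x => (φ x : ℂ)) ((deriv φ x : ℝ) : ℂ) x :=
      ((h1.differentiable (by simp)) x).hasDerivAt.ofReal_comp
    have d2 : HasDerivAt (fun x : ℝ => Complex.exp (c * x)) (Complex.exp (c * x) * c) x := by
      have d3 : HasDerivAt (fun x : ℝ => c * (x : ℂ)) c x := by
        simpa using (Complex.ofRealCLM.hasDerivAt (x := x)).const_mul c
      exact d3.cexp
    have d : HasDerivAt χ _ x := d1.mul d2
    rw [d.deriv, hχ]
    ring
  have h4 := h.integral_deriv_mul χ1 χ2 χ3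
  have hχb : ∀ w : L2Interval, Integrable (fun x => χ x * w x) (volume.restrict (Ioo (0 : ℝ) 1)) := by
    intro w
    obtain ⟨C, hC⟩ := χ2.exists_bound_of_continuous χ1.continuous
    exact (L2Interval.integrable w).bdd_mul (c := C) χ1.continuous.aestronglyMeasurable
      (Eventually.of_forall hC)
  have hdb : Integrable (fun x => deriv χ x * u x) (volume.restrict (Ioo (0 : ℝ) 1)) := by
    obtain ⟨C, hC⟩ := χ2.deriv.exists_bound_of_continuous (χ1.continuous_deriv (by simp))
    exact (L2Interval.integrable u).bdd_mul (c := C)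
      (χ1.continuous_deriv (by simp)).aestronglyMeasurable (Eventually.of_forall hC)
  have e1 : ∫ x in Ioo (0 : ℝ) 1, deriv φ x • ViscoWave.mulExp c u x
      = ∫ x in Ioo (0 : ℝ) 1, (deriv χ x * u x - c * (χ x * u x)) := by
    refine integral_congr_ae ?_
    filter_upwards [mulExp_coeFn c u] with x hx
    rw [hx, hd, Complex.real_smul]
    ring
  have e2 : ∫ x in Ioo (0 : ℝ) 1, φ x • ViscoWave.mulExp c (g + c • u) x
      = ∫ x in Ioo (0 : ℝ) 1, (χ x * g x + c * (χ x * u x)) := by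
    refine integral_congr_ae ?_
    filter_upwards [mulExp_coeFn c (g + c • u), Lp.coeFn_add g (c • u), Lp.coeFn_smul c u]
      with x h5 h6 h7
    rw [h5, h6, Pi.add_apply, h7, Pi.smul_apply, Complex.real_smul, hχ, smul_eq_mul]
    ring
  rw [e1, e2, integral_sub hdb ((hχb u).const_mul c), integral_add (hχb g) ((hχb u).const_mul c), h4]
  ring

theorem hasWeakDeriv_expL (c : ℂ) : HasWeakDeriv (expL c) (c • expL c) := by
  have h := hasWeakDeriv_oneL.mulExp c
  rwa [zero_add, map_smul] at h

/-- A solution of `u' = c u` is a multiple of `e^{cx}`. -/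
theorem HasWeakDeriv.eq_smul_expL {u : L2Interval} {c : ℂ} (h : HasWeakDeriv u (c • u)) :
    ∃ α : ℂ, u = α • expL c := by
  have h1 := h.mulExp (-c)
  rw [neg_smul, add_neg_cancel, map_zero] at h1
  obtain ⟨α, hα⟩ := h1.eq_smul_oneL
  refine ⟨α, ?_⟩
  rw [expL, ← map_smul, ← hα]
  have := mulExp_neg_mulExp (-c) u
  rw [neg_neg] at this
  exact this.symm

theorem HasTrace.unique {u : L2Interval} {a a' : BdrySpace} (h : HasTrace u a)
    (h' : HasTrace u a') : a = a' := by
  have h1 := h.add (h'.smul (-1))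
  rw [neg_one_smul, neg_one_smul, add_neg_cancel] at h1
  have := h1.eq_zero
  rwa [← sub_eq_add_neg, sub_eq_zero] at this

theorem HasTrace.mulExp {u : L2Interval} {a : BdrySpace} (h : HasTrace u a) (c : ℂ) :
    HasTrace (mulExp c u) !₂[a 0, Complex.exp c * a 1] := by
  obtain ⟨U, h1, h2, h3, h4⟩ := h
  refine ⟨fun x => Complex.exp (c * x) * U x,
    (continuous_cexp_mul c).continuousOn.mul h1, ?_, ?_, ?_⟩
  · filter_upwards [mulExp_coeFn c u, h2] with x e1 e2
    rw [e1, e2]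
  · simp [h3]
  · simp [h4]

theorem hasTrace_oneL : HasTrace oneL !₂[1, 1] :=
  ⟨fun _ => 1, continuousOn_const, oneL_coeFn, rfl, rfl⟩

theorem hasTrace_expL (c : ℂ) : HasTrace (expL c) !₂[1, Complex.exp c] := by
  simpa [expL] using hasTrace_oneL.mulExp c

/-! ### The primitive of a function in `L²(0,1)` -/

/-- The primitive vanishing at `0` of a function in `L²(0,1)`. -/
def primitiveFun (v : L2Interval) (x : ℝ) : ℂ :=
  ∫ y in (0 : ℝ)..x, v y ∂(volume.restrict (Ioo (0 : ℝ) 1))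

theorem L2Interval.intervalIntegrable (v : L2Interval) (a b : ℝ) :
    IntervalIntegrable v (volume.restrict (Ioo (0 : ℝ) 1)) a b :=
  (L2Interval.integrable v).intervalIntegrable

theorem continuous_primitiveFun (v : L2Interval) : Continuous (primitiveFun v) :=
  intervalIntegral.continuous_primitive (L2Interval.intervalIntegrable v) 0

theorem primitiveFun_of_mem {v : L2Interval} {x : ℝ} (hx : x ∈ Ioo (0 : ℝ) 1) :
    primitiveFun v x = ∫ y in Iio x, v y ∂(volume.restrict (Ioo (0 : ℝ) 1)) := by
  rw [primitiveFun, intervalIntegral.integral_of_le hx.1.le, integral_Ioc_eq_integral_Ioo,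
    Measure.restrict_restrict measurableSet_Ioo, Measure.restrict_restrict measurableSet_Iio]
  congr 2
  ext y
  simp only [mem_inter_iff, mem_Ioo, mem_Iio]
  grind

theorem primitiveFun_one (v : L2Interval) : primitiveFun v 1 = ∫ y in Ioo (0 : ℝ) 1, v y := by
  rw [primitiveFun, intervalIntegral.integral_of_le zero_le_one, integral_Ioc_eq_integral_Ioo,
    Measure.restrict_restrict measurableSet_Ioo, inter_self]

theorem integral_norm_le_norm (v : L2Interval) : ∫ y in Ioo (0 : ℝ) 1, ‖v y‖ ≤ ‖v‖ := by
  have h := Lp.aestronglyMeasurable v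
  rw [integral_norm_eq_lintegral_enorm h, ← eLpNorm_one_eq_lintegral_enorm, Lp.norm_def]
  exact ENNReal.toReal_mono (Lp.eLpNorm_ne_top v)
    (eLpNorm_le_eLpNorm_of_exponent_le one_le_two h)

theorem norm_primitiveFun_le (v : L2Interval) {x : ℝ} (hx : 0 ≤ x) : ‖primitiveFun v x‖ ≤ ‖v‖ := by
  rw [primitiveFun, intervalIntegral.integral_of_le hx]
  exact (norm_integral_le_integral_norm _).trans ((setIntegral_le_integral
    (L2Interval.integrable v).norm (Eventually.of_forall fun _ => norm_nonneg _)).trans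
    (integral_norm_le_norm v))

/-- The primitive vanishing at `0`, as a bounded operator on `L²(0,1)`. -/
def primitiveL : L2Interval →L[ℂ] L2Interval :=
  LinearMap.mkContinuous
    { toFun := fun v => (memLp_of_continuous (continuous_primitiveFun v) 2).toLp
      map_add' := fun v w => by
        rw [← MemLp.toLp_add]
        congr 1
        ext x
        rw [Pi.add_apply, primitiveFun, primitiveFun, primitiveFun,
          ← intervalIntegral.integral_add (v.intervalIntegrable 0 x) (w.intervalIntegrable 0 x)]
        exact intervalIntegral.integral_congr_ae' (by
            filter_upwards [Lp.coeFn_add v w] with y h _ using h) (by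
            filter_upwards [Lp.coeFn_add v w] with y h _ using h)
      map_smul' := fun c v => by
        rw [RingHom.id_apply, ← MemLp.toLp_const_smul]
        congr 1
        ext x
        rw [Pi.smul_apply, primitiveFun, primitiveFun, ← intervalIntegral.integral_smul]
        exact intervalIntegral.integral_congr_ae' (by
            filter_upwards [Lp.coeFn_smul c v] with y h _ using h) (by
            filter_upwards [Lp.coeFn_smul c v] with y h _ using h) }
    1 fun v => by
      refine (Lp.norm_le_of_ae_bound (norm_nonneg v) ?_).trans_eq ?_
      · filter_upwards [MemLp.coeFn_toLp (memLp_of_continuous (continuous_primitiveFun v) 2),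
          ae_restrict_mem measurableSet_Ioo] with x h hx
        exact (congrArg norm h).trans_le (norm_primitiveFun_le v hx.1.le)
      · simp [measureUnivNNReal]

theorem primitiveL_coeFn (v : L2Interval) :
    primitiveL v =ᵐ[volume.restrict (Ioo (0 : ℝ) 1)] primitiveFun v :=
  MemLp.coeFn_toLp (memLp_of_continuous (continuous_primitiveFun v) 2)

/-- Integration over `(0,1)`, as a bounded functional on `L²(0,1)`. -/
def totalL : L2Interval →L[ℂ] ℂ :=
  (ContinuousLinearMap.mul ℂ ℂ).lpPairing (volume.restrict (Ioo (0 : ℝ) 1)) 2 2 oneL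

theorem totalL_apply (v : L2Interval) : totalL v = ∫ y in Ioo (0 : ℝ) 1, v y := by
  rw [totalL, ContinuousLinearMap.lpPairing_eq_integral]
  refine integral_congr_ae ?_
  filter_upwards [oneL_coeFn] with x hx
  simp [hx]

theorem hasTrace_primitiveL (v : L2Interval) : HasTrace (primitiveL v) !₂[0, totalL v] := by
  refine ⟨primitiveFun v, (continuous_primitiveFun v).continuousOn, primitiveL_coeFn v, ?_, ?_⟩
  · simp [primitiveFun]
  · simp [primitiveFun_one, totalL_apply]

/-- Fubini on the triangle `y < x`; the inner integral of `φ'` over `(y, 1)` is `-φ(y)`. -/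
theorem hasWeakDeriv_primitiveL (v : L2Interval) : HasWeakDeriv (primitiveL v) v := by
  intro φ h1 h2 h3
  set μ : Measure ℝ := volume.restrict (Ioo (0 : ℝ) 1) with hμ
  have hv : Integrable v μ := L2Interval.integrable v
  have hd : Continuous (deriv φ) := h1.continuous_deriv (by simp)
  have hφ1 : φ 1 = 0 := image_eq_zero_of_notMem_tsupport fun h => by simpa using h3 h
  have hdi : Integrable (deriv φ) μ := (hd.integrable_of_hasCompactSupport h2.deriv).restrict
  have hprod : Integrable (fun q : ℝ × ℝ =>
      {q : ℝ × ℝ | q.2 < q.1}.indicator (fun q => deriv φ q.1 • v q.2) q) (μ.prod μ) :=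
    (hdi.smul_prod hv).indicator (measurableSet_lt measurable_snd measurable_fst)
  have hin : ∀ y ∈ Ioo (0 : ℝ) 1, ∫ x, (Ioi y).indicator (deriv φ) x ∂μ = - φ y := by
    intro y hy
    have : Ioi y ∩ Ioo (0 : ℝ) 1 = Ioo y 1 := by
      ext x
      simp only [mem_inter_iff, mem_Ioo, mem_Ioi]
      grind
    rw [integral_indicator measurableSet_Ioi, hμ, Measure.restrict_restrict measurableSet_Ioi, this,
      ← integral_Ioc_eq_integral_Ioo, ← intervalIntegral.integral_of_le hy.2.le,
      intervalIntegral.integral_deriv_eq_sub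
        (fun x _ => (h1.differentiable (by simp)).differentiableAt)
        (hd.intervalIntegrable _ _), hφ1, zero_sub]
  calc ∫ x, deriv φ x • (primitiveL v) x ∂μ
      = ∫ x, ∫ y, {q : ℝ × ℝ | q.2 < q.1}.indicator (fun q => deriv φ q.1 • v q.2) (x, y) ∂μ ∂μ := by
        refine integral_congr_ae ?_
        filter_upwards [primitiveL_coeFn v, ae_restrict_mem measurableSet_Ioo] with x e hx
        rw [e, primitiveFun_of_mem hx, ← integral_indicator measurableSet_Iio, ← integral_smul]
        refine integral_congr_ae (Eventually.of_forall fun y => ?_)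
        by_cases h : y < x <;> simp [indicator, h]
    _ = ∫ y, ∫ x, {q : ℝ × ℝ | q.2 < q.1}.indicator (fun q => deriv φ q.1 • v q.2) (x, y) ∂μ ∂μ :=
        integral_integral_swap hprod
    _ = ∫ y, -(φ y • v y) ∂μ := by
        refine integral_congr_ae ?_
        filter_upwards [ae_restrict_mem measurableSet_Ioo] with y hy
        rw [← neg_smul, ← hin y hy, ← integral_smul_const]
        refine integral_congr_ae (Eventually.of_forall fun x => ?_)
        by_cases h : y < x <;> simp [indicator, h]
    _ = -∫ y, φ y • v y ∂μ := integral_neg _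

/-- The solution of `w' = c w + f`, `w(0) = 0`. -/
def duhamelL (c : ℂ) : L2Interval →L[ℂ] L2Interval :=
  mulExp c ∘L primitiveL ∘L mulExp (-c)

theorem hasWeakDeriv_duhamelL (c : ℂ) (f : L2Interval) :
    HasWeakDeriv (duhamelL c f) (f + c • duhamelL c f) := by
  have h := (hasWeakDeriv_primitiveL (mulExp (-c) f)).mulExp c
  have e := mulExp_neg_mulExp (-c) f
  rw [neg_neg] at e
  rwa [map_add, map_smul, e] at h

/-- The value at `1` of the solution of `w' = c w + f`, `w(0) = 0`. -/
def duhamelEndL (c : ℂ) : L2Interval →L[ℂ] ℂ := Complex.exp c • totalL ∘L mulExp (-c)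

theorem hasTrace_duhamelL (c : ℂ) (f : L2Interval) :
    HasTrace (duhamelL c f) !₂[0, duhamelEndL c f] := by
  simpa [duhamelEndL, duhamelL] using (hasTrace_primitiveL (mulExp (-c) f)).mulExp c

/-! ### The memory component -/

theorem memLp_top_inv_add {z : ℂ} (hz : z.im ≠ 0) :
    MemLp (fun τ : ℝ => (z + (τ : ℂ))⁻¹) ∞ μ :=
  memLp_top_of_bound (Measurable.aestronglyMeasurable (by fun_prop)) _
    (Eventually.of_forall fun τ => norm_inv_add_le_inv_abs_im hz τ)

/-- One factor is bounded by `1/|Im z|` and the other is integrable, so no finiteness of the measure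
is needed. -/
theorem memLp_two_inv_add (hpos : ∀ᵐ τ ∂μ, 0 < τ) (hinv : Integrable (fun τ : ℝ => τ⁻¹) μ)
    {z : ℂ} (hz : z.im ≠ 0) : MemLp (fun τ : ℝ => (z + (τ : ℂ))⁻¹) 2 μ := by
  have h := integrable_inv_add hpos hinv hz
  rw [memLp_two_iff_integrable_sq_norm h.aestronglyMeasurable]
  refine (h.norm.const_mul |z.im|⁻¹).mono' (h.aestronglyMeasurable.norm.pow 2)
    (Eventually.of_forall fun τ => ?_)
  rw [Real.norm_of_nonneg (by positivity), sq]
  exact mul_le_mul_of_nonneg_right (norm_inv_add_le_inv_abs_im hz τ) (norm_nonneg _)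

/-- The functions `τ ↦ (z + τ)⁻¹ a` in `L²`, depending linearly on `a`. -/
def resolventEmbed {z : ℂ} (hm : MemLp (fun τ : ℝ => (z + (τ : ℂ))⁻¹) 2 μ) :
    BdrySpace →L[ℂ] Lp BdrySpace 2 μ :=
  LinearMap.toContinuousLinearMap
    { toFun := fun a => (ContinuousLinearMap.toSpanSingleton ℂ a).compLp hm.toLp
      map_add' := fun a b => by
        rw [ContinuousLinearMap.toSpanSingleton_add, ContinuousLinearMap.add_compLp]
      map_smul' := fun c a => by
        rw [ContinuousLinearMap.toSpanSingleton_smul, ContinuousLinearMap.smul_compLp,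
          RingHom.id_apply] }

theorem resolventEmbed_coeFn {z : ℂ} (hm : MemLp (fun τ : ℝ => (z + (τ : ℂ))⁻¹) 2 μ)
    (a : BdrySpace) : resolventEmbed hm a =ᵐ[μ] fun τ => (z + (τ : ℂ))⁻¹ • a := by
  have h := ContinuousLinearMap.coeFn_compLp (ContinuousLinearMap.toSpanSingleton ℂ a) hm.toLp
  filter_upwards [h, hm.coeFn_toLp] with τ h1 hτ
  refine h1.trans ?_
  rw [hτ, ContinuousLinearMap.toSpanSingleton_apply]

/-- The functional `h ↦ ∫ h(τ) / (z + τ) dμ(τ)`. -/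
def resolventPairing {z : ℂ} (hm : MemLp (fun τ : ℝ => (z + (τ : ℂ))⁻¹) 2 μ) :
    Lp BdrySpace 2 μ →L[ℂ] BdrySpace :=
  (ContinuousLinearMap.lsmul ℂ ℂ).lpPairing μ 2 2 hm.toLp

/-- The solution `ψ = (h + a) / (z + τ)` of `z ψ - a + τ ψ = h`. -/
def memoryL {z : ℂ} (hz : z.im ≠ 0) (hm : MemLp (fun τ : ℝ => (z + (τ : ℂ))⁻¹) 2 μ) :
    Lp BdrySpace 2 μ × BdrySpace →L[ℂ] Lp BdrySpace 2 μ :=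
  (mulL (memLp_top_inv_add hz)).coprod (resolventEmbed hm)

theorem memoryL_coeFn {z : ℂ} (hz : z.im ≠ 0)
    (hm : MemLp (fun τ : ℝ => (z + (τ : ℂ))⁻¹) 2 μ) (h : Lp BdrySpace 2 μ) (a : BdrySpace) :
    memoryL hz hm (h, a) =ᵐ[μ] fun τ => (z + (τ : ℂ))⁻¹ • (h τ + a) := by
  rw [memoryL, ContinuousLinearMap.coprod_apply]
  filter_upwards [Lp.coeFn_add (mulL (memLp_top_inv_add hz) h) (resolventEmbed hm a),
    mulL_coeFn (memLp_top_inv_add hz) h, resolventEmbed_coeFn hm a] with τ h1 h2 h3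
  rw [h1, Pi.add_apply, h2, h3, smul_add]

/-- Pointwise division by `z + τ ≠ 0`. The condition `τψ - Γp ∈ L²` needs no separate check, since
this function equals `h - zψ`. -/
theorem memoryL_equation {z : ℂ} (hz : z.im ≠ 0)
    (hm : MemLp (fun τ : ℝ => (z + (τ : ℂ))⁻¹) 2 μ) (h ψ : Lp BdrySpace 2 μ) (a : BdrySpace) :
    ((h - z • ψ : Lp BdrySpace 2 μ) =ᵐ[μ] fun τ => -a + (τ : ℂ) • ψ τ) ↔
      ψ = memoryL hz hm (h, a) := by
  have e : ∀ᵐ τ ∂μ, ((h - z • ψ : Lp BdrySpace 2 μ) τ = -a + (τ : ℂ) • ψ τ ↔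
      ψ τ = memoryL hz hm (h, a) τ) := by
    filter_upwards [Lp.coeFn_sub h (z • ψ), Lp.coeFn_smul z ψ, memoryL_coeFn hz hm h a]
      with τ h1 h2 h3
    rw [h1, Pi.sub_apply, h2, Pi.smul_apply, h3, eq_inv_smul_iff₀ (add_ofReal_ne_zero hz τ),
      add_smul, sub_eq_iff_eq_add, eq_comm]
    constructor <;> intro h4
    · rw [← h4]
      abel
    · rw [← sub_eq_iff_eq_add.2 h4.symm]
      abel
  rw [Lp.ext_iff]
  exact ⟨fun h' => by filter_upwards [h', e] with τ h1 h2 using h2.1 h1,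
    fun h' => by filter_upwards [h', e] with τ h1 h2 using h2.2 h1⟩

/-- This is where the impedance enters: the trace contributes `K(z) a`. The term with `h` is
integrable as a product of two `L²` functions. -/
theorem integral_memoryL (hpos : ∀ᵐ τ ∂μ, 0 < τ) (hinv : Integrable (fun τ : ℝ => τ⁻¹) μ)
    {z : ℂ} (hz : z.im ≠ 0) (hm : MemLp (fun τ : ℝ => (z + (τ : ℂ))⁻¹) 2 μ)
    (h : Lp BdrySpace 2 μ) (a : BdrySpace) :
    Integrable (memoryL hz hm (h, a)) μ ∧
      ∫ τ, memoryL hz hm (h, a) τ ∂μ = resolventPairing hm h + stieltjes μ z • a := by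
  have i1 : Integrable (fun τ : ℝ => (z + (τ : ℂ))⁻¹ • h τ) μ :=
    memLp_one_iff_integrable.1 ((Lp.memLp h).smul hm)
  have i2 : Integrable (fun τ : ℝ => (z + (τ : ℂ))⁻¹ • a) μ :=
    (integrable_inv_add hpos hinv hz).smul_const a
  have e := memoryL_coeFn hz hm h a
  simp only [smul_add] at e
  refine ⟨(i1.add i2).congr e.symm, ?_⟩
  rw [integral_congr_ae e, integral_add i1 i2, integral_smul_const, stieltjes, resolventPairing,
    ContinuousLinearMap.lpPairing_eq_integral]
  congr 1
  refine integral_congr_ae ?_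
  filter_upwards [hm.coeFn_toLp] with τ hτ
  rw [hτ, ContinuousLinearMap.lsmul_apply]

/-! ### The resolvent equation of the wave operator -/

/-- The state `(p, v, ψ)` assembled from its components. -/
def toEnergy (ν : Measure ℝ) : L2Interval × L2Interval × L2Bdry ν →L[ℂ] EnergySpace ν :=
  (WithLp.prodContinuousLinearEquiv 2 ℂ L2Interval
    (WithLp 2 (L2Interval × L2Bdry ν))).symm.toContinuousLinearMap ∘L
    (ContinuousLinearMap.id ℂ L2Interval).prodMap
      (WithLp.prodContinuousLinearEquiv 2 ℂ L2Interval (L2Bdry ν)).symm.toContinuousLinearMap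

theorem EnergySpace.ext {x y : EnergySpace ν} (h1 : pComp x = pComp y) (h2 : vComp x = vComp y)
    (h3 : psiComp x = psiComp y) : x = y :=
  WithLp.ofLp_injective 2 (Prod.ext h1 (WithLp.ofLp_injective 2 (Prod.ext h2 h3)))

theorem half_add_self {E : Type*} [AddCommGroup E] [Module ℂ E] (u v : E) :
    (1 / 2 : ℂ) • ((u + v) + (u - v)) = u ∧ (1 / 2 : ℂ) • ((u + v) - (u - v)) = v := by
  constructor <;> module

/-- Solutions of the resolvent equation, in terms of the Riemann invariants `p + v`, `p - v`. -/
theorem isWaveImage_of_invariants (hinv : Integrable (fun τ : ℝ => τ⁻¹) (ν.restrict (Ioi 0)))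
    {z : ℂ} (hz : z.im ≠ 0)
    (hm : MemLp (fun τ : ℝ => (z + (τ : ℂ))⁻¹) 2 (ν.restrict (Ioi 0)))
    (y : EnergySpace ν) {w₁ w₂ : L2Interval} {a₁ a₂ : BdrySpace}
    (h1 : HasWeakDeriv w₁ (pComp y + vComp y - z • w₁))
    (h2 : HasWeakDeriv w₂ (vComp y - pComp y + z • w₂))
    (t1 : HasTrace w₁ a₁) (t2 : HasTrace w₂ a₂)
    (b0 : (1 + stieltjes (ν.restrict (Ioi 0)) z) * a₁ 0
      - (1 - stieltjes (ν.restrict (Ioi 0)) z) * a₂ 0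
        = -2 * resolventPairing hm (psiComp y) 0)
    (b1 : (1 - stieltjes (ν.restrict (Ioi 0)) z) * a₁ 1
      - (1 + stieltjes (ν.restrict (Ioi 0)) z) * a₂ 1
        = 2 * resolventPairing hm (psiComp y) 1)
    {x : EnergySpace ν}
    (hx : x = toEnergy ν ((1 / 2 : ℂ) • (w₁ + w₂), (1 / 2 : ℂ) • (w₁ - w₂),
      memoryL hz hm (psiComp y, (1 / 2 : ℂ) • (a₁ + a₂)))) :
    IsWaveImage x (y - z • x) := by
  have hpos : ∀ᵐ τ ∂(ν.restrict (Ioi (0 : ℝ))), 0 < τ := ae_restrict_mem measurableSet_Ioi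
  have e1 : pComp x = (1 / 2 : ℂ) • (w₁ + w₂) := by rw [hx]; rfl
  have e2 : vComp x = (1 / 2 : ℂ) • (w₁ - w₂) := by rw [hx]; rfl
  have e3 : psiComp x = memoryL hz hm (psiComp y, (1 / 2 : ℂ) • (a₁ + a₂)) := by rw [hx]; rfl
  have f1 : pComp (y - z • x) = pComp y - z • pComp x := rfl
  have f2 : vComp (y - z • x) = vComp y - z • vComp x := rfl
  have f3 : psiComp (y - z • x) = psiComp y - z • psiComp x := rfl
  obtain ⟨i1, i2⟩ := integral_memoryL hpos hinv hz hm (psiComp y) ((1 / 2 : ℂ) • (a₁ + a₂))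
  refine ⟨?_, ?_, (1 / 2 : ℂ) • (a₁ + a₂), (1 / 2 : ℂ) • (a₁ + (-1 : ℂ) • a₂), ?_, ?_, ?_, ?_, ?_⟩
  · have h := (h1.add (h2.smul (-1))).smul (1 / 2)
    rw [f1, e1, e2]
    convert! h using 1 <;> module
  · have h := (h1.add h2).smul (1 / 2)
    rw [f2, e1, e2]
    convert! h using 1
    module
  · rw [e1]
    exact (t1.add t2).smul _
  · have h := (t1.add (t2.smul (-1))).smul (1 / 2)
    rw [e2]
    convert! h using 1
    module
  · rw [f3]
    exact (memoryL_equation hz hm _ _ _).2 e3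
  · rw [e3]
    exact i1
  · rw [e3, i2]
    intro i
    -- With `p = (a₁ + a₂)/2` and `v = (a₁ - a₂)/2`, the boundary condition at each endpoint is a
    -- multiple of `b0` or `b1`.
    fin_cases i
    · simp [outwardNormal]
      linear_combination (1 / 2) * b0
    · simp [outwardNormal]
      linear_combination (-1 / 2) * b1

/-- Solutions of the homogeneous resolvent equation. -/
theorem IsWaveImage.exists_invariants
    (hinv : Integrable (fun τ : ℝ => τ⁻¹) (ν.restrict (Ioi 0))) {z : ℂ} (hz : z.im ≠ 0)
    {x : EnergySpace ν} (h : IsWaveImage x (-(z • x))) :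
    ∃ α β : ℂ, pComp x + vComp x = α • expL (-z) ∧ pComp x - vComp x = β • expL z ∧
      (1 + stieltjes (ν.restrict (Ioi 0)) z) * α
        = (1 - stieltjes (ν.restrict (Ioi 0)) z) * β ∧
      (1 - stieltjes (ν.restrict (Ioi 0)) z) * (Complex.exp (-z) * α)
        = (1 + stieltjes (ν.restrict (Ioi 0)) z) * (Complex.exp z * β) ∧
      (α = 0 → β = 0 → x = 0) := by
  have hpos : ∀ᵐ τ ∂(ν.restrict (Ioi (0 : ℝ))), 0 < τ := ae_restrict_mem measurableSet_Ioi
  have hm := memLp_two_inv_add hpos hinv hz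
  obtain ⟨h1, h2, a, b, ta, tb, h3, -, h5⟩ := h
  have f1 : pComp (-(z • x)) = -(z • pComp x) := rfl
  have f2 : vComp (-(z • x)) = -(z • vComp x) := rfl
  have f3 : psiComp (-(z • x)) = 0 - z • psiComp x := by rw [zero_sub]; rfl
  rw [f1] at h1
  rw [f2] at h2
  rw [f3] at h3
  have hψ := (memoryL_equation hz hm _ _ _).1 h3
  obtain ⟨-, i2⟩ := integral_memoryL hpos hinv hz hm 0 a
  rw [hψ, i2, map_zero, zero_add] at h5
  have d1 : HasWeakDeriv (pComp x + vComp x) (-z • (pComp x + vComp x)) := by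
    convert! h2.add h1 using 1
    module
  have d2 : HasWeakDeriv (pComp x - vComp x) (z • (pComp x - vComp x)) := by
    convert! h2.add (h1.smul (-1)) using 1 <;> module
  obtain ⟨α, hα⟩ := d1.eq_smul_expL
  obtain ⟨β, hβ⟩ := d2.eq_smul_expL
  have t1 := ta.add tb
  have t2 := ta.add (tb.smul (-1))
  rw [hα] at t1
  rw [neg_one_smul, ← sub_eq_add_neg, hβ] at t2
  have u1 := t1.unique ((hasTrace_expL (-z)).smul α)
  have u2 := t2.unique ((hasTrace_expL z).smul β)
  have u10 : a 0 + b 0 = α := by simpa using congrArg (fun w : BdrySpace => w 0) u1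
  have u11 : a 1 + b 1 = α * Complex.exp (-z) := by
    simpa using congrArg (fun w : BdrySpace => w 1) u1
  have u20 : a 0 - b 0 = β := by
    simpa [sub_eq_add_neg] using congrArg (fun w : BdrySpace => w 0) u2
  have u21 : a 1 - b 1 = β * Complex.exp z := by
    simpa [sub_eq_add_neg] using congrArg (fun w : BdrySpace => w 1) u2
  have b0 : b 0 + stieltjes (ν.restrict (Ioi 0)) z * a 0 = 0 := by
    simpa [outwardNormal] using h5 0
  have b1 : -b 1 + stieltjes (ν.restrict (Ioi 0)) z * a 1 = 0 := by
    simpa [outwardNormal] using h5 1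
  refine ⟨α, β, hα, hβ, ?_, ?_, fun h6 h7 => ?_⟩
  · rw [← u10, ← u20]
    linear_combination 2 * b0
  · rw [mul_comm (Complex.exp (-z)), mul_comm (Complex.exp z), ← u11, ← u21]
    linear_combination (-2) * b1
  · rw [h6, zero_smul] at hα
    rw [h7, zero_smul] at hβ
    obtain ⟨p0, v0⟩ := half_add_self (pComp x) (vComp x)
    rw [hα, hβ, add_zero, smul_zero] at p0
    rw [hα, hβ, sub_zero, smul_zero] at v0
    have ha : a = 0 := by
      rw [← p0] at ta
      exact ta.eq_zero
    refine EnergySpace.ext p0.symm v0.symm ?_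
    rw [hψ, ha]
    exact map_zero _

theorem sub_waveOperator_apply_iff {z : ℂ} {x y : EnergySpace ν} :
    (∃ h : x ∈ (-waveOperator ν).domain, z • x - (-waveOperator ν) ⟨x, h⟩ = y) ↔
      IsWaveImage x (y - z • x) := by
  rw [← mem_graph_waveOperator, LinearPMap.mem_graph_iff]
  constructor
  · rintro ⟨h, rfl⟩
    refine ⟨⟨x, h⟩, rfl, ?_⟩
    rw [LinearPMap.neg_apply]
    simp
  · rintro ⟨⟨x', h⟩, rfl, h2⟩
    refine ⟨h, ?_⟩
    rw [LinearPMap.neg_apply, sub_neg_eq_add]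
    exact (congrArg _ h2).trans (add_sub_cancel _ _)

/-- An eigenvector has invariants `(1-K)e^{-zx}` and `(1+K)e^{zx}`. The condition at `0` holds by
this choice, and the one at `1` is the characteristic equation. The vector is nonzero since `1-K`
and `1+K` add up to `2`. -/
theorem mem_spectrum_of_characteristicFn_eq_zero
    (hinv : Integrable (fun τ : ℝ => τ⁻¹) (ν.restrict (Ioi 0))) {z : ℂ} (hz : z.im ≠ 0)
    (hD : characteristicFn (ν.restrict (Ioi 0)) z = 0) :
    z ∈ spectrumPMap (-waveOperator ν) := by
  have hpos : ∀ᵐ τ ∂(ν.restrict (Ioi (0 : ℝ))), 0 < τ := ae_restrict_mem measurableSet_Ioi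
  have hm := memLp_two_inv_add hpos hinv hz
  rintro ⟨S, -, hS⟩
  set K := stieltjes (ν.restrict (Ioi 0)) z with hK
  have hE : Complex.exp z * Complex.exp (-z) = 1 := by rw [← Complex.exp_add]; simp
  have hE2 : Complex.exp (2 * z) = Complex.exp z * Complex.exp z := by
    rw [two_mul, Complex.exp_add]
  rw [characteristicFn, hE2, ← hK] at hD
  have t1 := (hasTrace_expL (-z)).smul (1 - K)
  have t2 := (hasTrace_expL z).smul (1 + K)
  have d1 : HasWeakDeriv ((1 - K) • expL (-z))
      (pComp (0 : EnergySpace ν) + vComp (0 : EnergySpace ν) - z • ((1 - K) • expL (-z))) := by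
    convert! (hasWeakDeriv_expL (-z)).smul (1 - K) using 1
    change (0 : L2Interval) + 0 - _ = _
    module
  have d2 : HasWeakDeriv ((1 + K) • expL z)
      (vComp (0 : EnergySpace ν) - pComp (0 : EnergySpace ν) + z • ((1 + K) • expL z)) := by
    convert! (hasWeakDeriv_expL z).smul (1 + K) using 1
    change (0 : L2Interval) - 0 + _ = _
    module
  have e0 : psiComp (0 : EnergySpace ν) = 0 := rfl
  have hx := isWaveImage_of_invariants hinv hz hm 0 d1 d2 t1 t2
    (by
      rw [e0, map_zero]
      simp
      ring)
    (by
      rw [e0, map_zero]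
      simp
      linear_combination (-Complex.exp (-z)) * hD
        + (1 + K) ^ 2 * Complex.exp z * hE) rfl
  obtain ⟨h, hxe⟩ := sub_waveOperator_apply_iff.2 hx
  have h0 := hS ⟨_, h⟩
  rw [hxe, map_zero] at h0
  have p0 : (1 / 2 : ℂ) • ((1 - K) • expL (-z) + (1 + K) • expL z) = 0 :=
    (congrArg pComp h0).symm
  have v0 : (1 / 2 : ℂ) • ((1 - K) • expL (-z) - (1 + K) • expL z) = 0 :=
    (congrArg vComp h0).symm
  have w1 : (1 - K) • expL (-z) = 0 := by
    rw [show (1 - K) • expL (-z) = (1 / 2 : ℂ) • ((1 - K) • expL (-z) + (1 + K) • expL z)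
      + (1 / 2 : ℂ) • ((1 - K) • expL (-z) - (1 + K) • expL z) by module, p0, v0, add_zero]
  have w2 : (1 + K) • expL z = 0 := by
    rw [show (1 + K) • expL z = (1 / 2 : ℂ) • ((1 - K) • expL (-z) + (1 + K) • expL z)
      - (1 / 2 : ℂ) • ((1 - K) • expL (-z) - (1 + K) • expL z) by module, p0, v0, sub_zero]
  rw [w1] at t1
  rw [w2] at t2
  have k1 : 1 - K = 0 := by simpa using congrArg (fun w : BdrySpace => w 0) t1.eq_zero
  have k2 : 1 + K = 0 := by simpa using congrArg (fun w : BdrySpace => w 0) t2.eq_zero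
  have : (2 : ℂ) = 0 := by linear_combination k1 + k2
  norm_num at this

/-- Variation of constants: each invariant is an exponential plus a Duhamel term, with coefficients
determined by the boundary system. Every ingredient is a continuous linear map of the data, so
boundedness of the inverse is automatic. -/
theorem mem_resolventSet_of_characteristicFn_ne_zero
    (hinv : Integrable (fun τ : ℝ => τ⁻¹) (ν.restrict (Ioi 0))) {z : ℂ} (hz : z.im ≠ 0)
    (hD : characteristicFn (ν.restrict (Ioi 0)) z ≠ 0) :
    z ∈ resolventSetPMap (-waveOperator ν) := by
  have hpos : ∀ᵐ τ ∂(ν.restrict (Ioi (0 : ℝ))), 0 < τ := ae_restrict_mem measurableSet_Ioi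
  have hm := memLp_two_inv_add hpos hinv hz
  set K := stieltjes (ν.restrict (Ioi 0)) z with hK
  have hE : Complex.exp z * Complex.exp (-z) = 1 := by rw [← Complex.exp_add]; simp
  have hE2 : Complex.exp (2 * z) = Complex.exp z * Complex.exp z := by
    rw [two_mul, Complex.exp_add]
  rw [characteristicFn, hE2, ← hK] at hD
  set e := Complex.exp z
  set e' := Complex.exp (-z)
  -- The determinant of the boundary system, equal to `-e^{-z}` times the characteristic function.
  set D : ℂ := (1 - K) ^ 2 * e' - (1 + K) ^ 2 * e with hDdef
  have hD0 : D ≠ 0 := fun h => hD (by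
    rw [hDdef] at h
    linear_combination (-e) * h + (1 - K) ^ 2 * hE)
  have huniq : ∀ x : EnergySpace ν, IsWaveImage x (-(z • x)) → x = 0 := by
    intro x hx
    obtain ⟨α, β, -, -, h3, h4, h5⟩ := hx.exists_invariants hinv hz
    refine h5 ((mul_eq_zero.1 (?_ : D * α = 0)).resolve_left hD0)
      ((mul_eq_zero.1 (?_ : D * β = 0)).resolve_left hD0)
    · rw [hDdef]
      linear_combination (1 - K) * h4 - (1 + K) * e * h3
    · rw [hDdef]
      linear_combination (1 + K) * h4 - (1 - K) * e' * h3
  let pL : EnergySpace ν →L[ℂ] L2Interval := WithLp.fstL 2 ℂ L2Interval _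
  let vL : EnergySpace ν →L[ℂ] L2Interval :=
    (WithLp.fstL 2 ℂ L2Interval (L2Bdry ν)) ∘L (WithLp.sndL 2 ℂ L2Interval _)
  let ψL : EnergySpace ν →L[ℂ] L2Bdry ν :=
    (WithLp.sndL 2 ℂ L2Interval (L2Bdry ν)) ∘L (WithLp.sndL 2 ℂ L2Interval _)
  let proj : Fin 2 → BdrySpace →L[ℂ] ℂ := fun i => EuclideanSpace.proj i
  let F : EnergySpace ν →L[ℂ] ℂ := duhamelEndL (-z) ∘L (pL + vL)
  let G : EnergySpace ν →L[ℂ] ℂ := duhamelEndL z ∘L (vL - pL)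
  let r0 : EnergySpace ν →L[ℂ] ℂ := (-2 : ℂ) • (proj 0 ∘L resolventPairing hm ∘L ψL)
  let r1 : EnergySpace ν →L[ℂ] ℂ :=
    (2 : ℂ) • (proj 1 ∘L resolventPairing hm ∘L ψL) - (1 - K) • F + (1 + K) • G
  -- Cramer's rule for `(1+K)α - (1-K)β = r0` and `(1-K)e'α - (1+K)eβ = r1`; the Duhamel endpoint
  -- values have been moved into `r1`.
  let α : EnergySpace ν →L[ℂ] ℂ := D⁻¹ • ((1 - K) • r1 - ((1 + K) * e) • r0)
  let β : EnergySpace ν →L[ℂ] ℂ := D⁻¹ • ((1 + K) • r1 - ((1 - K) * e') • r0)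
  let W₁ : EnergySpace ν →L[ℂ] L2Interval := α.smulRight (expL (-z)) + duhamelL (-z) ∘L (pL + vL)
  let W₂ : EnergySpace ν →L[ℂ] L2Interval := β.smulRight (expL z) + duhamelL z ∘L (vL - pL)
  let A₁ : EnergySpace ν →L[ℂ] BdrySpace := α.smulRight !₂[1, e'] + F.smulRight !₂[0, 1]
  let A₂ : EnergySpace ν →L[ℂ] BdrySpace := β.smulRight !₂[1, e] + G.smulRight !₂[0, 1]
  let S : EnergySpace ν →L[ℂ] EnergySpace ν := toEnergy ν ∘L
    ((1 / 2 : ℂ) • (W₁ + W₂)).prod (((1 / 2 : ℂ) • (W₁ - W₂)).prod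
      (memoryL hz hm ∘L ψL.prod ((1 / 2 : ℂ) • (A₁ + A₂))))
  have hS : ∀ y, IsWaveImage (S y) (y - z • S y) := by
    intro y
    have hα : D * α y = (1 - K) * r1 y - (1 + K) * e * r0 y := mul_inv_cancel_left₀ hD0 _
    have hβ : D * β y = (1 + K) * r1 y - (1 - K) * e' * r0 y := mul_inv_cancel_left₀ hD0 _
    have hr0 : r0 y = -2 * resolventPairing hm (psiComp y) 0 := rfl
    have hr1 : r1 y = 2 * resolventPairing hm (psiComp y) 1 - (1 - K) * F y + (1 + K) * G y := rfl
    have eW₁ : W₁ y = α y • expL (-z) + duhamelL (-z) (pComp y + vComp y) := rfl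
    have eW₂ : W₂ y = β y • expL z + duhamelL z (vComp y - pComp y) := rfl
    have a10 : A₁ y 0 = α y := by simp [A₁]
    have a11 : A₁ y 1 = α y * e' + F y := by simp [A₁]
    have hF : F y = duhamelEndL (-z) (pComp y + vComp y) := rfl
    have hG : G y = duhamelEndL z (vComp y - pComp y) := rfl
    have a20 : A₂ y 0 = β y := by simp [A₂]
    have a21 : A₂ y 1 = β y * e + G y := by simp [A₂]
    refine isWaveImage_of_invariants hinv hz hm y (w₁ := W₁ y) (w₂ := W₂ y) (a₁ := A₁ y)
      (a₂ := A₂ y) ?_ ?_ ?_ ?_ ?_ ?_ rfl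
    · rw [eW₁]
      convert! ((hasWeakDeriv_expL (-z)).smul (α y)).add
        (hasWeakDeriv_duhamelL (-z) (pComp y + vComp y)) using 1
      module
    · rw [eW₂]
      convert! ((hasWeakDeriv_expL z).smul (β y)).add
        (hasWeakDeriv_duhamelL z (vComp y - pComp y)) using 1
      module
    · rw [eW₁]
      convert! ((hasTrace_expL (-z)).smul (α y)).add
        (hasTrace_duhamelL (-z) (pComp y + vComp y)) using 1
      ext i
      fin_cases i
      · simpa using a10
      · simpa [hF] using a11
    · rw [eW₂]
      convert! ((hasTrace_expL z).smul (β y)).add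
        (hasTrace_duhamelL z (vComp y - pComp y)) using 1
      ext i
      fin_cases i
      · simpa using a20
      · simpa [hG] using a21
    · rw [a10, a20, ← hr0]
      refine mul_left_cancel₀ hD0 ?_
      rw [hDdef] at hα hβ ⊢
      linear_combination (1 + K) * hα - (1 - K) * hβ
    · rw [a11, a21]
      refine mul_left_cancel₀ hD0 ?_
      rw [hDdef] at hα hβ ⊢
      linear_combination (1 - K) * e' * hα - (1 + K) * e * hβ
        + ((1 - K) ^ 2 * e' - (1 + K) ^ 2 * e) * hr1
  refine ⟨S, fun y => sub_waveOperator_apply_iff.2 (hS y), fun x => ?_⟩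
  set y := z • (x : EnergySpace ν) - (-waveOperator ν) x with hy
  have hx : IsWaveImage (x : EnergySpace ν) (y - z • (x : EnergySpace ν)) :=
    sub_waveOperator_apply_iff.1 ⟨x.2, rfl⟩
  -- Both `S y` and `x` solve the equation with data `y`, so their difference solves the homogeneous
  -- one.
  have hd := (hS y).add (hx.smul (-1))
  rw [← sub_eq_zero]
  refine huniq _ ?_
  convert! hd using 1 <;> module

theorem spectrum_iff_characteristicFn
    {ν : Measure ℝ} (hinv : Integrable (fun τ : ℝ => τ⁻¹) (ν.restrict (Ioi 0))) {z : ℂ}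
    (hz : z.im ≠ 0) :
    z ∈ spectrumPMap (-waveOperator ν) ↔ characteristicFn (ν.restrict (Ioi 0)) z = 0 := by
  refine ⟨fun h => ?_, mem_spectrum_of_characteristicFn_eq_zero hinv hz⟩
  by_contra hD
  exact h (mem_resolventSet_of_characteristicFn_ne_zero hinv hz hD)

end ViscoWave

end

/-! ### From zeros of the characteristic function to the indexed sequence -/

theorem mainTheorem11 (k : ℝ → ℝ) (ν : Measure ℝ) (hk : IsCompletelyMonotonic k ν)
    (hint : IntegrableOn k (Ioi 0)) (hne : ∃ t : ℝ, 0 < t ∧ k t ≠ 0) (H : ℝ) (hH : 0 < H) :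
    ∃ R₀ C : ℝ, 0 < R₀ ∧ ∀ R : ℝ, R₀ ≤ R → ∃ n₀ : ℕ, 0 < n₀ ∧ ∃ z : ℤ → ℂ,
      spectrumPMap (-waveOperator ν) ∩ stripRegion H R = z '' {n : ℤ | (n₀ : ℤ) ≤ |n|} ∧
      InjOn z {n : ℤ | (n₀ : ℤ) ≤ |n|} ∧
      (∀ n : ℤ, (n₀ : ℤ) ≤ |n| → z (-n) = (starRingEnd ℂ) (z n)) ∧
      ∀ n : ℤ, (n₀ : ℤ) ≤ |n| → ∃ ε δ : ℝ,
        |ε| ≤ C * ‖impedance k (Complex.I * (Real.pi * n))‖ ∧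
        |δ| ≤ C * ‖impedance k (Complex.I * (Real.pi * n))‖ ∧
        (z n).im = Real.pi * n - (2 + ε) * (impedance k (Complex.I * (Real.pi * n))).im ∧
        (z n).re = -((2 + δ) * (impedance k (Complex.I * (Real.pi * n))).re) := by

  have hinv := (hk.ae_integrableOn hint).2
  rw [hk.restrict_Ici_eq hint] at hinv
  have hpos : ∀ᵐ τ ∂(ν.restrict (Ioi (0 : ℝ))), 0 < τ := ae_restrict_mem measurableSet_Ioi
  obtain ⟨N, hN0, z, hz, hall⟩ :=
    exists_characteristicFn_zeros hpos hinv (hk.restrict_ne_zero hint hne) hH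
  have hpi := Real.pi_gt_three
  have hNr : (1 : ℝ) ≤ N := by exact_mod_cast hN0
  refine ⟨Real.pi * N + 1, 3, by positivity, fun R hR => ?_⟩
  have hRpos : 0 < R := lt_of_lt_of_le (by positivity) hR
  have him : ∀ n : ℕ, N ≤ n → |(z n).im - Real.pi * n| ≤ 1 := fun n hn => by
    simpa using (hz n (by simpa using hn)).2.1
  have habs : ∀ n : ℤ, (N : ℤ) ≤ |n| → |(z n).im| = (z (n.natAbs : ℤ)).im ∧ N ≤ n.natAbs := by
    intro n hn
    have hn' : N ≤ n.natAbs := by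
      rw [Int.abs_eq_natAbs] at hn
      exact_mod_cast hn
    refine ⟨?_, hn'⟩
    have hnr : (N : ℝ) ≤ (n.natAbs : ℝ) := by exact_mod_cast hn'
    have h1 := (abs_le.1 (him _ hn')).1
    have h2 : 0 ≤ (z (n.natAbs : ℤ)).im := by nlinarith
    rcases Int.natAbs_eq n with h | h
    · rw [← h] at h2 ⊢
      exact abs_of_nonneg h2
    · have h3 := (hz n hn).2.2.2.2.1
      rw [show -n = (n.natAbs : ℤ) by omega] at h3
      rw [h3, Complex.conj_im] at h2 ⊢
      exact abs_of_nonpos (by linarith)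
  have hex : ∃ n : ℕ, N ≤ n ∧ R < (z n).im := by
    obtain ⟨n, hn⟩ := exists_nat_gt (max (N : ℝ) R)
    obtain ⟨hn1, hn2⟩ := max_lt_iff.1 hn
    have hn3 : N ≤ n := by exact_mod_cast hn1.le
    refine ⟨n, hn3, ?_⟩
    have := (abs_le.1 (him n hn3)).1
    nlinarith
  classical
  -- The cutoff is the first index at least `N` whose zero lies above height `R`; by conjugation,
  -- nonnegative indices suffice.
  set n₀ := Nat.find hex with hn₀
  obtain ⟨hNn, hRn⟩ : N ≤ n₀ ∧ R < (z n₀).im := Nat.find_spec hex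
  have hup : ∀ n : ℕ, n₀ ≤ n → R < (z n).im := by
    intro n hn
    rcases hn.eq_or_lt with rfl | hlt
    · exact hRn
    -- Zeros lie within 1 of centres spaced by `π > 2`, so later indices give higher zeros.
    · have h1 := (abs_le.1 (him n (hNn.trans hn))).1
      have h2 := (abs_le.1 (him n₀ hNn)).2
      have h3 : (n₀ : ℝ) + 1 ≤ n := by exact_mod_cast hlt
      nlinarith
  have hNle : ∀ n : ℤ, (n₀ : ℤ) ≤ |n| → (N : ℤ) ≤ |n| := fun n hn => by omega
  refine ⟨n₀, hN0.trans_le hNn, z, ?_, ?_, fun n hn => (hz n (hNle n hn)).2.2.2.2.1, fun n hn => ?_⟩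
  · ext w
    simp only [mem_inter_iff, mem_image, mem_ofPred_eq]
    constructor
    · rintro ⟨hw, hw1, hw2, hw3⟩
      have hw0 : w.im ≠ 0 := abs_pos.1 (hRpos.trans hw1)
      obtain ⟨n, hn, rfl⟩ := hall w ⟨lt_of_le_of_lt hR hw1, hw2, hw3⟩
        ((spectrum_iff_characteristicFn hinv hw0).1 hw)
      obtain ⟨h1, h2⟩ := habs n hn
      rw [h1] at hw1
      -- Minimality of `n₀` shows that no zero above height `R` has a smaller index.
      have := Nat.find_min' hex ⟨h2, hw1⟩
      exact ⟨n, by rw [Int.abs_eq_natAbs]; exact_mod_cast this, rfl⟩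
    · rintro ⟨n, hn, rfl⟩
      obtain ⟨h1, -⟩ := habs n (hNle n hn)
      have h2 := hup n.natAbs (by rw [Int.abs_eq_natAbs] at hn; exact_mod_cast hn)
      rw [← h1] at h2
      obtain ⟨g1, -, g2, g3, -⟩ := hz n (hNle n hn)
      exact ⟨(spectrum_iff_characteristicFn hinv (abs_pos.1 (hRpos.trans h2))).2 g1, h2, g2, g3⟩
  · intro n hn m hm hnm
    have h1 := (hz n (hNle n hn)).2.1
    have h2 := (hz m (hNle m hm)).2.1
    rw [hnm] at h1
    rw [abs_le] at h1 h2
    have h3 : (n : ℝ) < m + 1 := by nlinarith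
    have h4 : (m : ℝ) < n + 1 := by nlinarith
    have h5 : n < m + 1 := by exact_mod_cast h3
    have h6 : m < n + 1 := by exact_mod_cast h4
    omega
  · rw [hk.impedance_eq hint (by simp)]
    exact (hz n (hNle n hn)).2.2.2.2.2
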